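/- Let $F$ be a distribution function on $\mathbb{R}$ of a law concentrated on $[1,\infty)$ that is heavy-tailed: $1-F(x)=x^{-1/\gamma}L(x)$ for $x>0$, where $\gamma>0$ and $L$ is slowly varying at infinity, i.e. $L(tx)/L(t)\to1$ as $t\to\infty$ for every $x>0$. Let $F^-(u)=\inf\{x: F(x)\ge u\}$ and $U(y)=F^-(1-1/y)$, and assume that there are $\rho<0$ and a measurable function $A$ with $\lim_{t\to\infty}A(t)=0$ such that $$\lim_{t\to\infty}\frac{U(tx)/U(t)-x^{\gamma}}{A(t)}=x^{\gamma}\,\frac{x^{\rho}-1}{\rho}\qquad\text{for all }x>0. \tag{U}$$ For each $n$ let there be $k_n$ blocks, where block $i$ consists of $m_i=m_{n,i}$ random variables, all the random variables in all $k_n$ blocks being independent with distribution function $F$, and $\sum_{i=1}^{k_n}m_i\sim n$ as $n\to\infty$ (in particular this holds if $\sum_i m_i=n$). Let $X^{(i)}_{m_i,1}\ge\dots\ge X^{(i)}_{m_i,m_i}$ be the order statistics of block $i$, of which only the $r_i+1$ largest are observed, where $r_i=r_{n,i}\ge1$ and $r_i+1\le m_i$. For $p\in(0,1)$ put $x_p=F^-(1-p)$,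 $$a(m,r,p)=\sum_{j=r+1}^{m}\frac1j+\log p,\qquad a_n(p)=\frac{1}{\sum_{i=1}^{k_n}r_i}\sum_{i=1}^{k_n}r_i\,a(m_i,r_i,p),$$ $$\widehat\gamma_n^*=\frac{1}{\sum_{i=1}^{k_n}r_i}\sum_{i=1}^{k_n}\sum_{j=1}^{r_i}\bigl(\log X^{(i)}_{m_i,j}-\log X^{(i)}_{m_i,r_i+1}\bigr),$$ and, for a sequence $p=p_n\in(0,1)$, $$\widehat x_p^*=\exp\Bigl(\frac{1}{\sum_{i=1}^{k_n}r_i}\sum_{i=1}^{k_n}r_i\log X^{(i)}_{m_i,r_i+1}-a_n(p_n)\,\widehat\gamma_n^*\Bigr).$$ Suppose that, as $n\to\infty$, $k_n\to\infty$, $n/k_n\to\infty$, $q_n=\min_{1\le i\le k_n}m_i/r_i\to\infty$, $\bigl(\sum_{i=1}^{k_n}r_i\bigr)^{1/2}A(q_n)\to0$, $\max_{1\le i\le k_n}m_ip_n\to0$ and $a_n(p_n)=o\bigl((\sum_{i=1}^{k_n}r_i)^{1/2}\bigr)$. Then $$\frac{\bigl(\sum_{i=1}^{k_n}r_i\bigr)^{1/2}}{|a_n(p_n)|}\bigl(\log\widehat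 x_p^*-\log x_p\bigr)\to N(0,\gamma^2)\quad\text{in distribution as }n\to\infty.$$ -/

import Mathlib

open Filter Topology MeasureTheory ProbabilityTheory Asymptotics

noncomputable section

namespace BlockQuantile

/-- `L` is slowly varying at infinity. -/
def SlowlyVarying (L : ℝ → ℝ) : Prop :=
  ∀ x : ℝ, 0 < x → Tendsto (fun t : ℝ => L (t * x) / L t) atTop (𝓝 1)

/-- The law `μ` on the real line is heavy-tailed with tail index `1/γ`: its distribution function
`F` satisfies `1 - F x = x ^ (-1/γ) * L x` for all `x > 0`, with `L` slowly varying. -/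
def HeavyTailed (μ : Measure ℝ) (γ : ℝ) : Prop :=
  ∃ L : ℝ → ℝ, SlowlyVarying L ∧ ∀ x : ℝ, 0 < x → 1 - cdf μ x = x ^ (-1 / γ) * L x

/-- The generalized inverse `F⁻ u = inf {x | u ≤ F x}` of the distribution function of `μ`. -/
def quantile (μ : Measure ℝ) (u : ℝ) : ℝ :=
  sInf {x : ℝ | u ≤ cdf μ x}

/-- The tail quantile function `U y = F⁻ (1 - 1/y)`, `y > 1`. -/
def tailQuantile (μ : Measure ℝ) (y : ℝ) : ℝ :=
  quantile μ (1 - 1 / y)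

/-- The high quantile `x_p = F⁻ (1 - p)`. -/
def highQuantile (μ : Measure ℝ) (p : ℝ) : ℝ :=
  quantile μ (1 - p)

/-- The second-order regular variation condition on `U`. The limit on the right is nonzero for
`x ≠ 1`, so the condition forces `A t ≠ 0` for all large `t`. -/
def SecondOrder (μ : Measure ℝ) (γ ρ : ℝ) (A : ℝ → ℝ) : Prop :=
  Measurable A ∧ Tendsto A atTop (𝓝 0) ∧
    ∀ x : ℝ, 0 < x →
      Tendsto (fun t : ℝ => (tailQuantile μ (t * x) / tailQuantile μ t - x ^ γ) / A t) atTop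
        (𝓝 (x ^ γ * ((x ^ ρ - 1) / ρ)))

/-- The `j`-th largest of the `N` numbers `x 0, …, x (N - 1)`, for `1 ≤ j ≤ N`
(and `0` for other `j`). `Tuple.sort x` arranges `x` in nondecreasing order. -/
def orderStat {N : ℕ} (x : Fin N → ℝ) (j : ℕ) : ℝ :=
  if h : 1 ≤ j ∧ j ≤ N then x (Tuple.sort x ⟨N - j, by omega⟩) else 0

/-- `a(m, r, p) = ∑_{j=r+1}^m 1/j + log p`. -/
def blockA (m r : ℕ) (p : ℝ) : ℝ :=
  (∑ j ∈ Finset.Icc (r + 1) m, 1 / (j : ℝ)) + Real.log p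

/-- `∑ r_i` over the `k` blocks, as a real number. -/
def totalR {k : ℕ} (r : Fin k → ℕ) : ℝ :=
  ∑ i, (r i : ℝ)

/-- `a_n(p) = (∑ r_i)⁻¹ ∑ r_i a(m_i, r_i, p)`. -/
def weightedA {k : ℕ} (m r : Fin k → ℕ) (p : ℝ) : ℝ :=
  (totalR r)⁻¹ * ∑ i, (r i : ℝ) * blockA (m i) (r i) p

/-- The Hill-type estimator of `γ` from the `r_i + 1` largest observations in each block. -/
def gammaHat {k : ℕ} {m : Fin k → ℕ} (r : Fin k → ℕ) (x : (i : Fin k) → Fin (m i) → ℝ) : ℝ :=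
  (totalR r)⁻¹ * ∑ i, ∑ j ∈ Finset.Icc 1 (r i),
    (Real.log (orderStat (x i) j) - Real.log (orderStat (x i) (r i + 1)))

/-- The weighted estimator of the high quantile `x_p`. -/
def quantileHat {k : ℕ} {m : Fin k → ℕ} (r : Fin k → ℕ) (p : ℝ)
    (x : (i : Fin k) → Fin (m i) → ℝ) : ℝ :=
  Real.exp ((totalR r)⁻¹ * (∑ i, (r i : ℝ) * Real.log (orderStat (x i) (r i + 1)))
    - weightedA m r p * gammaHat r x)

end BlockQuantile

end

/-! An observation has the law of `U (exp E)` with `E` standard exponential. By Rényi's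
representation (`map_sortVec_eq_map_renyiVec`), the `j`-th largest of `m` exponentials is `∑_{l=j}^m
Z_l / l` with i.i.d. standard exponential `Z_l`, so both halves of the estimator become explicit
linear forms in the `Z_l`, provided `log U` is nearly affine in `log y`.

This is what `ρ < 0` gives (`SecondOrder.log_tailQuantile_approx`): the increments of `log U (exp w)
- γ w` are `O(|A (exp w)|)`, and `|A (exp w)|` decays geometrically, so the function converges to a
constant `c` at rate `A`. The error is needed at random levels `w`, hence the factor `1 + exp (M (u
- w))`, which comes from Potter-type bounds.

Without that error, `log x̂_p - log x_p = γ N - a_n (γ̂ - γ)`, where `N` is the centred weighted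
mean of the exponential intermediate order statistics. Since `a_n → -∞`, eventually `-a_n = |a_n|`,
and the normalized error is `√R (γ̂ - γ) + γ √R N / |a_n|`, with `R = ∑ r_i`. The first term is a
normalized sum of `R` centred exponentials and obeys the central limit theorem. The second vanishes
because `E|N| ≤ R^{-1/2}`. The approximation error, taken at `u = log q_n`, costs `√R |A (q_n)|`
times a factor of bounded mean (`integral_errorLevel_le`). -/

/-! ### Slow variation in additive form -/

/-- If `f` is measurable with asymptotically constant increments, then along any sequence tending
to infinity the increments are controlled on a large subset of `[0, 2]`. -/
lemma eventually_volume_increment_gt {f : ℝ → ℝ} {ℓ : ℝ → ℝ} {b : ℝ}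
    (hℓ : ∀ v, Tendsto (fun u => f (u + v) - f u) atTop (𝓝 (ℓ v)))
    (hb : ∀ v ∈ Set.Icc (0 : ℝ) 2, |ℓ v| < b) {y : ℕ → ℝ} (hy : Tendsto y atTop atTop) :
    ∀ᶠ n in atTop, ENNReal.ofReal (3 / 2) <
      volume {v ∈ Set.Icc (0 : ℝ) 2 | ∀ j ≥ n, |f (y j + v) - f (y j)| ≤ b} := by
  set V : ℕ → Set ℝ := fun n => {v ∈ Set.Icc (0 : ℝ) 2 | ∀ j ≥ n, |f (y j + v) - f (y j)| ≤ b}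
  have hmono : Monotone V := fun n n' hnn v hv => ⟨hv.1, fun j hj => hv.2 j (hnn.trans hj)⟩
  have hU : ⋃ n, V n = Set.Icc (0 : ℝ) 2 := by
    apply Set.Subset.antisymm
    · exact Set.iUnion_subset fun n v hv => hv.1
    · intro v hv
      have h1 : Tendsto (fun j => |f (y j + v) - f (y j)|) atTop (𝓝 |ℓ v|) :=
        ((hℓ v).comp hy).abs
      obtain ⟨n, hn⟩ := eventually_atTop.1 (h1.eventually_lt_const (hb v hv))
      exact Set.mem_iUnion.2 ⟨n, hv, fun j hj => (hn j hj).le⟩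
  have ht := tendsto_measure_iUnion_atTop (μ := volume) hmono
  rw [hU, Real.volume_Icc] at ht
  exact ht.eventually_const_lt (by rw [ENNReal.ofReal_lt_ofReal_iff] <;> norm_num)

/-- Local boundedness of the increments of a measurable function whose increments converge. -/
lemma exists_increment_bound {f : ℝ → ℝ} (hf : Measurable f) {ρ : ℝ}
    (hℓ : ∀ v, Tendsto (fun u => f (u + v) - f u) atTop (𝓝 (ρ * v))) :
    ∃ M T : ℝ, 0 ≤ M ∧ ∀ u ≥ T, ∀ v ∈ Set.Icc (0 : ℝ) 1, |f (u + v) - f u| ≤ M := by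
  by_contra! H
  set b : ℝ := 2 * |ρ| + 1
  have hb0 : 0 ≤ b := by positivity
  have hb : ∀ v ∈ Set.Icc (0 : ℝ) 2, |ρ * v| < b := by
    intro v hv
    rw [abs_mul, abs_of_nonneg hv.1]
    nlinarith [abs_nonneg ρ, hv.2]
  -- From counterexamples `(x n, u n)`, compare the `v` with small increments from `x n` to the `v`
  -- with small increments from `x n + u n`, shifted by `u n`. Both sets lie in `[0, 3]` and have
  -- measure above `3 / 2`, so they meet; at a common point the triangle inequality contradicts `2 *
  -- b < |f (x n + u n) - f (x n)|`.
  choose x hx u hu hxu using fun n : ℕ => H (2 * b) n (by positivity)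
  have hxt : Tendsto x atTop atTop := tendsto_atTop_mono hx tendsto_natCast_atTop_atTop
  have hyt : Tendsto (fun n => x n + u n) atTop atTop :=
    tendsto_atTop_mono (fun n => by linarith [(hu n).1]) hxt
  obtain ⟨n, h1, h2⟩ := ((eventually_volume_increment_gt hℓ hb hxt).and
    (eventually_volume_increment_gt hℓ hb hyt)).exists
  set V := {v ∈ Set.Icc (0 : ℝ) 2 | ∀ j ≥ n, |f (x j + v) - f (x j)| ≤ b}
  set W := {v ∈ Set.Icc (0 : ℝ) 2 | ∀ j ≥ n, |f (x j + u j + v) - f (x j + u j)| ≤ b}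
  set W' := (fun v => v + -u n) ⁻¹' W
  have hW' : volume W' = volume W := measure_preimage_add_right _ _ _
  have hWm : MeasurableSet W' := by
    have hW : W = Set.Icc (0 : ℝ) 2 ∩
        ⋂ j ≥ n, {v | |f (x j + u j + v) - f (x j + u j)| ≤ b} := by
      ext v; simp [W]
    rw [show W' = (fun v => v + -u n) ⁻¹' W from rfl, hW]
    refine (measurable_id.add_const (-u n)) (measurableSet_Icc.inter ?_)
    refine MeasurableSet.iInter fun j => MeasurableSet.iInter fun _ => ?_
    exact measurableSet_le (by fun_prop) measurable_const
  have hsub : V ∪ W' ⊆ Set.Icc 0 3 := by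
    rintro v (hv | hv)
    · exact ⟨hv.1.1, by linarith [hv.1.2]⟩
    · have h3 := hv.1.1
      have h4 := hv.1.2
      simp only at h3 h4
      exact ⟨by linarith [(hu n).1], by linarith [(hu n).2]⟩
  by_cases hdisj : Disjoint V W'
  · have h3 := measure_mono (μ := volume) hsub
    rw [measure_union hdisj hWm, Real.volume_Icc, hW'] at h3
    have h4 := ENNReal.add_lt_add h1 h2
    rw [← ENNReal.ofReal_add (by norm_num) (by norm_num)] at h4
    norm_num at h3 h4
    exact absurd (h4.trans_le h3) (lt_irrefl _)
  · obtain ⟨v, hv, hw⟩ := Set.not_disjoint_iff.1 hdisj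
    have h3 := hv.2 n le_rfl
    have h4 := hw.2 n le_rfl
    have h5 : x n + u n + (v + -u n) = x n + v := by ring
    simp only [h5] at h4
    have h6 := hxu n
    rw [abs_le] at h3 h4
    rcases lt_abs.1 h6 with h | h <;> linarith [h3.1, h3.2, h4.1, h4.2]

/-- Potter-type bounds for a positive measurable function of exponential type with negative
index. -/
lemma exists_potter_bound {B : ℝ → ℝ} (hB : Measurable B) {ρ : ℝ} (hρ : ρ < 0)
    (hpos : ∀ᶠ u in atTop, 0 < B u)
    (hrat : ∀ v, Tendsto (fun u => B (u + v) / B u) atTop (𝓝 (Real.exp (ρ * v)))) :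
    ∃ M T θ : ℝ, 0 ≤ M ∧ 0 < θ ∧ θ < 1 ∧ (∀ u ≥ T, 0 < B u) ∧
      (∀ u ≥ T, B (u + 1) ≤ θ * B u) ∧ (∀ u ≥ T, ∀ w ≥ u, B w ≤ Real.exp M * B u) ∧
      ∀ u ≥ T, ∀ w ≥ u, B u ≤ Real.exp (M * (w - u + 1)) * B w := by
  have hf : Measurable fun u => Real.log (B u) := hB.log
  have hℓ : ∀ v, Tendsto (fun u => Real.log (B (u + v)) - Real.log (B u)) atTop (𝓝 (ρ * v)) := by
    intro v
    have h := (hrat v).log (Real.exp_pos _).ne'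
    rw [Real.log_exp] at h
    refine h.congr' ?_
    filter_upwards [hpos, (tendsto_atTop_add_const_right atTop v tendsto_id).eventually hpos]
      with u h1 h2
    exact Real.log_div (by simpa using h2.ne') h1.ne'
  obtain ⟨M, T₀, hM, hMT⟩ := exists_increment_bound hf hℓ
  -- Any `θ` strictly between the limit `exp ρ` of `B (u + 1) / B u` and `1` would serve.
  have hθ : Real.exp ρ < Real.exp (ρ / 2) := Real.exp_lt_exp.2 (by linarith)
  have h1 := (hrat 1).eventually_lt_const (show Real.exp (ρ * 1) < Real.exp (ρ / 2) by
    rwa [mul_one])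
  obtain ⟨T₁, hT₁⟩ := eventually_atTop.1 (h1.and hpos)
  set T := max T₀ T₁
  have hT : ∀ u ≥ T, 0 < B u := fun u hu => (hT₁ u ((le_max_right _ _).trans hu)).2
  have hstep : ∀ u ≥ T, B (u + 1) ≤ Real.exp (ρ / 2) * B u := fun u hu =>
    ((div_lt_iff₀ (hT u hu)).1 (hT₁ u ((le_max_right _ _).trans hu)).1).le
  have hloc : ∀ u ≥ T, ∀ v ∈ Set.Icc (0 : ℝ) 1,
      B (u + v) ≤ Real.exp M * B u ∧ B u ≤ Real.exp M * B (u + v) := by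
    intro u hu v hv
    have h2 := abs_le.1 (hMT u ((le_max_left _ _).trans hu) v hv)
    have h3 := hT u hu
    have h4 := hT (u + v) (hu.trans (by linarith [hv.1]))
    constructor
    · rw [← Real.exp_log h3, ← Real.exp_log h4, ← Real.exp_add]
      exact Real.exp_le_exp.2 (by linarith [h2.2])
    · rw [← Real.exp_log h3, ← Real.exp_log h4, ← Real.exp_add]
      exact Real.exp_le_exp.2 (by linarith [h2.1])
  have hnat : ∀ n : ℕ, ∀ u ≥ T, B (u + n) ≤ B u ∧ B u ≤ Real.exp (M * n) * B (u + n) := by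
    intro n
    induction n with
    | zero => intro u _; simp
    | succ n ih =>
      intro u hu
      have hun : u + n ≥ T := hu.trans (by simp)
      have h2 := ih u hu
      have h3 := hstep (u + n) hun
      have h4 := (hloc (u + n) hun 1 ⟨zero_le_one, le_rfl⟩).2
      have h5 : u + ((n + 1 : ℕ) : ℝ) = u + n + 1 := by push_cast; ring
      rw [h5]
      constructor
      · have h6 : Real.exp (ρ / 2) ≤ 1 := Real.exp_le_one_iff.2 (by linarith)
        nlinarith [hT _ hun]
      · have h6 : M * ((n + 1 : ℕ) : ℝ) = M * n + M := by push_cast; ring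
        rw [h6, Real.exp_add, mul_assoc]
        exact h2.2.trans (mul_le_mul_of_nonneg_left h4 (Real.exp_pos _).le)
  refine ⟨M, T, Real.exp (ρ / 2), hM, Real.exp_pos _, Real.exp_lt_one_iff.2 (by linarith), hT, hstep,
    ?_, ?_⟩
  · intro u hu w hw
    have hfl := Nat.floor_le (sub_nonneg.2 hw)
    have hfl' := Nat.lt_floor_add_one (w - u)
    have h2 := (hloc (u + ⌊w - u⌋₊) (hu.trans (by simp)) (w - u - ⌊w - u⌋₊)
      ⟨by linarith, by linarith⟩).1
    rw [show u + (⌊w - u⌋₊ : ℝ) + (w - u - ⌊w - u⌋₊) = w by ring] at h2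
    exact h2.trans (mul_le_mul_of_nonneg_left (hnat _ u hu).1 (Real.exp_pos _).le)
  · intro u hu w hw
    have hfl := Nat.floor_le (sub_nonneg.2 hw)
    have hfl' := Nat.lt_floor_add_one (w - u)
    have h2 := (hloc (u + ⌊w - u⌋₊) (hu.trans (by simp)) (w - u - ⌊w - u⌋₊)
      ⟨by linarith, by linarith⟩).2
    rw [show u + (⌊w - u⌋₊ : ℝ) + (w - u - ⌊w - u⌋₊) = w by ring] at h2
    have h3 := (hnat ⌊w - u⌋₊ u hu).2
    have h4 : Real.exp (M * ⌊w - u⌋₊) * Real.exp M ≤ Real.exp (M * (w - u + 1)) := by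
      rw [← Real.exp_add]
      exact Real.exp_le_exp.2 (by nlinarith)
    calc B u ≤ _ := h3
      _ ≤ Real.exp (M * ⌊w - u⌋₊) * (Real.exp M * B w) :=
        mul_le_mul_of_nonneg_left h2 (Real.exp_pos _).le
      _ = Real.exp (M * ⌊w - u⌋₊) * Real.exp M * B w := by ring
      _ ≤ _ := mul_le_mul_of_nonneg_right h4 (hT w (hu.trans hw)).le

/-- A function whose increments are dominated by a function `B` of exponential type with negative
index converges, at rate `B`. -/
lemma exists_limit_with_rate {B η : ℝ → ℝ} (hB : Measurable B) {ρ : ℝ} (hρ : ρ < 0)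
    (hpos : ∀ᶠ u in atTop, 0 < B u) (hB0 : Tendsto B atTop (𝓝 0))
    (hrat : ∀ v, Tendsto (fun u => B (u + v) / B u) atTop (𝓝 (Real.exp (ρ * v))))
    (hη : ∀ v, ∃ C, ∀ᶠ u in atTop, |η (u + v) - η u| ≤ C * B u)
    (hbd : ∀ T, ∃ C, ∀ u, 0 ≤ u → u ≤ T → |η u| ≤ C) :
    ∃ c K M T : ℝ, 0 ≤ K ∧ 0 ≤ M ∧ ∀ u ≥ T, ∀ w ≥ 0,
      |η w - c| ≤ K * B u * (1 + Real.exp (M * (u - w))) := by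
  obtain ⟨M, T₀, θ, hM, hθ0, hθ1, hT₀, hstep, hup, hdown⟩ := exists_potter_bound hB hρ hpos hrat
  obtain ⟨C, hC⟩ := hη 1
  obtain ⟨T₁, hT₁⟩ := eventually_atTop.1 hC
  set T := max T₀ T₁
  have hT0 : T₀ ≤ T := le_max_left _ _
  have hpow : ∀ u ≥ T, ∀ n : ℕ, B (u + n) ≤ B u * θ ^ n := by
    intro u hu n
    induction n with
    | zero => simp
    | succ n ih =>
      have h := hstep (u + n) (hT0.trans (hu.trans (by simp)))
      rw [show u + ((n + 1 : ℕ) : ℝ) = u + n + 1 by push_cast; ring, pow_succ]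
      nlinarith
  have hC0 : 0 ≤ C := by
    have h1 := (abs_nonneg _).trans (hT₁ T (le_max_right _ _))
    exact nonneg_of_mul_nonneg_left h1 (hT₀ T hT0)
  have hinc : ∀ u ≥ T, ∀ n : ℕ, dist (η (u + n)) (η (u + (n + 1 : ℕ))) ≤ C * B u * θ ^ n := by
    intro u hu n
    rw [dist_comm, Real.dist_eq,
      show u + ((n + 1 : ℕ) : ℝ) = u + n + 1 by push_cast; ring]
    refine (hT₁ (u + n) ((le_max_right T₀ T₁).trans (hu.trans (by simp)))).trans ?_
    rw [mul_assoc]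
    exact mul_le_mul_of_nonneg_left (hpow u hu n) hC0
  have hlim : ∀ u ≥ T, ∃ c, Tendsto (fun n : ℕ => η (u + n)) atTop (𝓝 c) ∧
      |η u - c| ≤ C * B u / (1 - θ) := by
    intro u hu
    obtain ⟨c, hc⟩ := cauchySeq_tendsto_of_complete
      (cauchySeq_of_le_geometric θ (C * B u) hθ1 (hinc u hu))
    refine ⟨c, hc, ?_⟩
    have := dist_le_of_le_geometric_of_tendsto₀ θ (C * B u) hθ1 (hinc u hu) hc
    simpa [Real.dist_eq] using this
  obtain ⟨c, hc, -⟩ := hlim T le_rfl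
  have hrate : ∀ u ≥ T, |η u - c| ≤ C * B u / (1 - θ) := by
    intro u hu
    obtain ⟨c', hc', hb⟩ := hlim u hu
    -- The limit along `u + ℕ` does not depend on `u`: the increment over the fixed gap `u - T` is
    -- `O(B)` and `B` tends to `0`.
    suffices c' = c by rwa [this] at hb
    obtain ⟨C', hC'⟩ := hη (u - T)
    have hTn : Tendsto (fun n : ℕ => T + (n : ℝ)) atTop atTop :=
      tendsto_atTop_add_const_left _ _ tendsto_natCast_atTop_atTop
    have h0 : Tendsto (fun n : ℕ => η (T + n + (u - T)) - η (T + n)) atTop (𝓝 0) := by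
      refine squeeze_zero_norm' (a := fun n : ℕ => C' * B (T + n)) (hTn.eventually hC') ?_
      simpa using (hB0.comp hTn).const_mul C'
    have h1 : Tendsto (fun n : ℕ => η (T + n + (u - T)) - η (T + n)) atTop (𝓝 (c' - c)) := by
      refine Tendsto.sub (hc'.congr fun n => ?_) hc
      congr 1; ring
    exact sub_eq_zero.1 (tendsto_nhds_unique h1 h0)
  obtain ⟨K₀, hK₀⟩ := hbd T
  have hBT := hT₀ T hT0
  have hθ' : 0 < 1 - θ := by linarith
  -- The first summand is the geometric-series rate for `w ≥ T`; the second turns the crude bound on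
  -- `[0, T]` into a multiple of `B T`.
  set K₁ := C / (1 - θ) + (|K₀| + |c|) / B T
  have hK₁ : 0 ≤ K₁ := by positivity
  refine ⟨c, K₁ * Real.exp M, M, T, by positivity, hM, fun u hu w hw => ?_⟩
  have hBu := hT₀ u (hT0.trans hu)
  -- reduce to a comparison with `B (max w T)`
  have hmax : |η w - c| ≤ K₁ * B (max w T) := by
    rcases le_total T w with h | h
    · rw [max_eq_left h]
      have hBw := hT₀ w (hT0.trans h)
      refine (hrate w h).trans ?_
      rw [mul_div_right_comm]
      exact mul_le_mul_of_nonneg_right (le_add_of_nonneg_right (by positivity)) hBw.le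
    · rw [max_eq_right h]
      have h2 := hK₀ w hw h
      have h3 : K₁ * B T = C / (1 - θ) * B T + (|K₀| + |c|) := by
        simp only [K₁]; field_simp
      rw [h3]
      have h4 : 0 ≤ C / (1 - θ) * B T := by positivity
      have h5 := abs_sub (η w) c
      linarith [le_abs_self K₀]
  refine hmax.trans ?_
  rw [mul_assoc, mul_assoc]
  refine mul_le_mul_of_nonneg_left ?_ hK₁
  -- Above `u` the function `B` is at most `exp M * B u`; below `u` it may be larger, and the
  -- exponential in `u - w` pays for that.
  rcases le_total u (max w T) with h | h
  · have h2 := hup u (hT0.trans hu) _ h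
    refine h2.trans (mul_le_mul_of_nonneg_left ?_ (Real.exp_pos _).le)
    exact le_mul_of_one_le_right hBu.le (by linarith [Real.exp_pos (M * (u - w))])
  · have h2 := hdown (max w T) (hT0.trans (le_max_right _ _)) u h
    have h3 : Real.exp (M * (u - max w T + 1)) ≤ Real.exp M * Real.exp (M * (u - w)) := by
      rw [← Real.exp_add]
      exact Real.exp_le_exp.2 (by nlinarith [le_max_left w T])
    calc _ ≤ _ := h2
      _ ≤ Real.exp M * Real.exp (M * (u - w)) * B u := mul_le_mul_of_nonneg_right h3 hBu.le
      _ ≤ _ := by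
        rw [mul_assoc, mul_comm (Real.exp (M * (u - w)))]
        gcongr
        linarith

namespace BlockQuantile

/-! ### The quantile transform -/

/-- The default value `0` of `sInf` lies below every quantile at a positive level, so the quantile
transform stays monotone on the whole line. -/
lemma quantile_of_nonpos (μ : Measure ℝ) {u : ℝ} (hu : u ≤ 0) : quantile μ u = 0 := by
  have : {x : ℝ | u ≤ cdf μ x} = Set.univ :=
    Set.eq_univ_of_forall fun x => hu.trans (cdf_nonneg μ x)
  rw [quantile, this, Real.sInf_univ]

section

variable {μ : Measure ℝ}

lemma cdf_eq_zero_of_lt_one [IsProbabilityMeasure μ] (hμ : ∀ᵐ x ∂μ, 1 ≤ x)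
    {x : ℝ} (hx : x < 1) : cdf μ x = 0 := by
  rw [cdf_eq_real, measureReal_eq_zero_iff]
  refine measure_mono_null (fun y hy => ?_) (ae_iff.1 hμ)
  exact not_le.2 (lt_of_le_of_lt hy hx)

lemma one_le_of_le_cdf [IsProbabilityMeasure μ] (hμ : ∀ᵐ x ∂μ, 1 ≤ x)
    {u x : ℝ} (hu : 0 < u) (hx : u ≤ cdf μ x) : 1 ≤ x := by
  by_contra! h
  rw [cdf_eq_zero_of_lt_one hμ h] at hx
  linarith

lemma nonempty_le_cdf {u : ℝ} (hu : u < 1) : {x : ℝ | u ≤ cdf μ x}.Nonempty := by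
  obtain ⟨x, hx⟩ := ((tendsto_cdf_atTop μ).eventually_const_lt hu).exists
  exact ⟨x, hx.le⟩

lemma one_le_quantile [IsProbabilityMeasure μ] (hμ : ∀ᵐ x ∂μ, 1 ≤ x)
    {u : ℝ} (hu : 0 < u) (hu1 : u < 1) : 1 ≤ quantile μ u :=
  le_csInf (nonempty_le_cdf hu1) fun _ hx => one_le_of_le_cdf hμ hu hx

/-- Right continuity of the distribution function makes the infimum attained, which turns the
generalized inverse into a Galois adjoint. -/
lemma quantile_le_iff [IsProbabilityMeasure μ] (hμ : ∀ᵐ x ∂μ, 1 ≤ x)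
    {u x : ℝ} (hu : 0 < u) (hu1 : u < 1) : quantile μ u ≤ x ↔ u ≤ cdf μ x := by
  have hbdd : BddBelow {x : ℝ | u ≤ cdf μ x} := ⟨1, fun _ hx => one_le_of_le_cdf hμ hu hx⟩
  refine ⟨fun h => ?_, fun h => csInf_le hbdd h⟩
  have hlim : Tendsto (cdf μ) (𝓝[>] x) (𝓝 (cdf μ x)) :=
    ((cdf μ).right_continuous x).tendsto.mono_left (nhdsWithin_mono _ Set.Ioi_subset_Ici_self)
  refine ge_of_tendsto hlim ?_
  filter_upwards [self_mem_nhdsWithin] with y hy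
  obtain ⟨z, hz, hzy⟩ := exists_lt_of_csInf_lt (nonempty_le_cdf hu1) (lt_of_le_of_lt h hy)
  exact hz.trans (monotone_cdf μ hzy.le)

lemma monotone_quantile_of_lt_one [IsProbabilityMeasure μ] (hμ : ∀ᵐ x ∂μ, 1 ≤ x)
    {u v : ℝ} (huv : u ≤ v) (hv : v < 1) :
    quantile μ u ≤ quantile μ v := by
  rcases le_or_gt u 0 with hu | hu
  · rw [quantile_of_nonpos μ hu]
    rcases le_or_gt v 0 with hv0 | hv0
    · rw [quantile_of_nonpos μ hv0]
    · exact zero_le_one.trans (one_le_quantile hμ hv0 hv)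
  · rw [quantile_le_iff hμ hu (huv.trans_lt hv)]
    exact huv.trans ((quantile_le_iff hμ (hu.trans_le huv) hv).1 le_rfl)

lemma tailQuantile_exp (e : ℝ) :
    tailQuantile μ (Real.exp e) = quantile μ (1 - Real.exp (-e)) := by
  rw [tailQuantile, one_div, Real.exp_neg]

lemma monotone_tailQuantile_exp [IsProbabilityMeasure μ] (hμ : ∀ᵐ x ∂μ, 1 ≤ x) :
    Monotone fun e => tailQuantile μ (Real.exp e) := by
  intro a b hab
  simp only [tailQuantile_exp]
  refine monotone_quantile_of_lt_one hμ ?_ (by linarith [Real.exp_pos (-b)])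
  linarith [Real.exp_le_exp.2 (neg_le_neg hab)]

lemma one_le_tailQuantile [IsProbabilityMeasure μ] (hμ : ∀ᵐ x ∂μ, 1 ≤ x)
    {y : ℝ} (hy : 1 < y) : 1 ≤ tailQuantile μ y := by
  have h0 : 0 < y := by linarith
  refine one_le_quantile hμ ?_ ?_
  · rw [sub_pos, div_lt_one h0]
    exact hy
  · have := div_pos one_pos h0
    linarith

lemma log_tailQuantile_exp_nonneg [IsProbabilityMeasure μ] (hμ : ∀ᵐ x ∂μ, 1 ≤ x)
    (e : ℝ) : 0 ≤ Real.log (tailQuantile μ (Real.exp e)) := by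
  rcases le_or_gt e 0 with h | h
  · rw [tailQuantile_exp, quantile_of_nonpos]
    · simp
    · linarith [Real.one_le_exp (neg_nonneg.2 h)]
  · exact Real.log_nonneg (one_le_tailQuantile hμ (Real.one_lt_exp_iff.2 h))

lemma log_tailQuantile_exp_mono [IsProbabilityMeasure μ] (hμ : ∀ᵐ x ∂μ, 1 ≤ x)
    {a b : ℝ} (hab : a ≤ b) :
    Real.log (tailQuantile μ (Real.exp a)) ≤ Real.log (tailQuantile μ (Real.exp b)) := by
  rcases le_or_gt a 0 with h | h
  · rw [tailQuantile_exp, quantile_of_nonpos, Real.log_zero]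
    · exact log_tailQuantile_exp_nonneg hμ b
    · linarith [Real.one_le_exp (neg_nonneg.2 h)]
  · exact Real.log_le_log (zero_lt_one.trans_le (one_le_tailQuantile hμ (Real.one_lt_exp_iff.2 h)))
      (monotone_tailQuantile_exp hμ hab)

/-- The quantile transform: if `E` is standard exponential then `U (exp E)` has law `μ`. -/
lemma hasLaw_tailQuantile_exp [IsProbabilityMeasure μ] (hμ : ∀ᵐ x ∂μ, 1 ≤ x) :
    HasLaw (fun e => tailQuantile μ (Real.exp e)) μ (expMeasure 1) where
  aemeasurable := (monotone_tailQuantile_exp hμ).measurable.aemeasurable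
  map_eq := by
    have := isProbabilityMeasure_expMeasure one_pos
    have hm := (monotone_tailQuantile_exp hμ).measurable
    have := Measure.isProbabilityMeasure_map (μ := expMeasure 1) hm.aemeasurable
    refine Measure.ext_of_Iic _ _ fun x => ?_
    rw [Measure.map_apply hm measurableSet_Iic, ← ofReal_cdf]
    have hIic : ∀ b : ℝ, 0 ≤ b → expMeasure 1 (Set.Iic b) = ENNReal.ofReal (1 - Real.exp (-b)) := by
      intro b hb
      rw [← ofReal_cdf, cdf_expMeasure_eq one_pos, if_pos hb, one_mul]
    -- For `e ≤ 0` the quantile is a default value and the Galois correspondence is unavailable.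
    have hpos : ∀ᵐ e ∂(expMeasure 1), 0 < e := by
      rw [ae_iff]
      simpa [Set.Iic_def] using hIic 0 le_rfl
    have hset : ((fun e => tailQuantile μ (Real.exp e)) ⁻¹' Set.Iic x)
        =ᵐ[expMeasure 1] {e | 1 - Real.exp (-e) ≤ cdf μ x} := by
      filter_upwards [hpos] with e he
      have h1 : 0 < 1 - Real.exp (-e) := by
        have : Real.exp (-e) < 1 := Real.exp_lt_one_iff.2 (by linarith)
        linarith
      have h2 : 1 - Real.exp (-e) < 1 := by linarith [Real.exp_pos (-e)]
      apply propext
      change tailQuantile μ (Real.exp e) ≤ x ↔ 1 - Real.exp (-e) ≤ cdf μ x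
      rw [tailQuantile_exp, quantile_le_iff hμ h1 h2]
    rw [measure_congr hset]
    rcases (cdf_le_one μ x).lt_or_eq with h | h
    · have h1 : 0 < 1 - cdf μ x := by linarith
      have h2 : {e | 1 - Real.exp (-e) ≤ cdf μ x} = Set.Iic (-Real.log (1 - cdf μ x)) := by
        ext e
        simp only [Set.mem_ofPred_eq, Set.mem_Iic]
        rw [le_neg, Real.log_le_iff_le_exp h1]
        constructor <;> intro <;> linarith
      rw [h2, hIic, neg_neg, Real.exp_log h1, sub_sub_cancel]
      have := Real.log_nonpos h1.le (by linarith [cdf_nonneg μ x])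
      linarith
    · have h2 : {e | 1 - Real.exp (-e) ≤ cdf μ x} = Set.univ := by
        refine Set.eq_univ_of_forall fun e => ?_
        simp only [Set.mem_ofPred_eq, h]
        linarith [Real.exp_pos (-e)]
      rw [h2, h, measure_univ, ENNReal.ofReal_one]

end

/-! ### Consequences of the second-order condition -/

section

variable {μ : Measure ℝ} {γ ρ : ℝ} {A : ℝ → ℝ}

/-- Where `A t = 0` the quotient is `0` by convention, but at `x = 2` its limit is nonzero. -/
lemma SecondOrder.eventually_ne (hρ : ρ < 0) (hU : SecondOrder μ γ ρ A) :
    ∀ᶠ t in atTop, A t ≠ 0 := by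
  have h := hU.2.2 2 two_pos
  have h2 : (2 : ℝ) ^ ρ < 1 := Real.rpow_lt_one_of_one_lt_of_neg one_lt_two hρ
  have h3 : (2 : ℝ) ^ γ * (((2 : ℝ) ^ ρ - 1) / ρ) ≠ 0 :=
    mul_ne_zero (Real.rpow_pos_of_pos two_pos _).ne' (div_ne_zero (by linarith) hρ.ne)
  filter_upwards [h.eventually_ne h3] with t ht h0
  simp [h0] at ht

lemma SecondOrder.tendsto_sub (hρ : ρ < 0) (hU : SecondOrder μ γ ρ A) {x : ℝ} (hx : 0 < x) :
    Tendsto (fun t => tailQuantile μ (t * x) / tailQuantile μ t - x ^ γ) atTop (𝓝 0) := by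
  have h := (hU.2.2 x hx).mul hU.2.1
  rw [mul_zero] at h
  refine h.congr' ?_
  filter_upwards [hU.eventually_ne hρ] with t ht
  exact div_mul_cancel₀ _ ht

/-- Regular variation of `A` follows from the factorization `U(2xt)/U(t) = (U(2xt)/U(xt))
(U(xt)/U(t))`: with `H` the limit function, `H(2x) - 2^γ H(x) = x^ρ x^γ H(2)`, and `H(2) ≠ 0` may be
divided out. -/
lemma SecondOrder.tendsto_ratio [IsProbabilityMeasure μ] (hμ : ∀ᵐ x ∂μ, 1 ≤ x) (hρ : ρ < 0) (hU : SecondOrder μ γ ρ A)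
    {x : ℝ} (hx : 0 < x) : Tendsto (fun t => A (t * x) / A t) atTop (𝓝 (x ^ ρ)) := by
  have h2 : (2 : ℝ) ^ ρ < 1 := Real.rpow_lt_one_of_one_lt_of_neg one_lt_two hρ
  have h2γ : 0 < (2 : ℝ) ^ γ := Real.rpow_pos_of_pos two_pos _
  have hxγ : 0 < x ^ γ := Real.rpow_pos_of_pos hx _
  have h2ρ : ((2 : ℝ) ^ ρ - 1) / ρ ≠ 0 := div_ne_zero (by linarith) hρ.ne
  have htx : Tendsto (fun t : ℝ => t * x) atTop atTop := tendsto_id.atTop_mul_const hx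
  have hUx : Tendsto (fun t => tailQuantile μ (t * x) / tailQuantile μ t) atTop (𝓝 (x ^ γ)) := by
    simpa using (hU.tendsto_sub hρ hx).add_const (x ^ γ)
  have hD2 := ((hU.2.2 2 two_pos).comp htx).mul hUx
  have hnum := (hU.2.2 (x * 2) (by positivity)).sub ((hU.2.2 x hx).const_mul ((2 : ℝ) ^ γ))
  have h := hnum.div hD2 (mul_ne_zero (mul_ne_zero h2γ.ne' h2ρ) hxγ.ne')
  have hval : ((x * 2) ^ γ * (((x * 2) ^ ρ - 1) / ρ) - 2 ^ γ * (x ^ γ * ((x ^ ρ - 1) / ρ))) /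
      (2 ^ γ * ((2 ^ ρ - 1) / ρ) * x ^ γ) = x ^ ρ := by
    rw [div_eq_iff (mul_ne_zero (mul_ne_zero h2γ.ne' h2ρ) hxγ.ne'),
      Real.mul_rpow hx.le zero_le_two, Real.mul_rpow hx.le zero_le_two]
    field_simp
    ring
  rw [hval] at h
  refine h.congr' ?_
  have hD2ne := hD2.eventually_ne (mul_ne_zero (mul_ne_zero h2γ.ne' h2ρ) hxγ.ne')
  filter_upwards [hU.eventually_ne hρ, htx.eventually (hU.eventually_ne hρ), hD2ne,
    eventually_gt_atTop 1, htx.eventually (eventually_gt_atTop 1)] with t hA hAx hne ht htx1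
  have hUt := one_le_tailQuantile hμ ht
  have hUtx := one_le_tailQuantile hμ htx1
  simp only [Function.comp_apply, Pi.div_apply] at hne ⊢
  rw [div_eq_iff hne, ← mul_assoc t x 2, Real.mul_rpow hx.le zero_le_two]
  field_simp
  ring

lemma abs_log_one_add_le {δ : ℝ} (hδ : |δ| ≤ 1 / 2) : |Real.log (1 + δ)| ≤ 2 * |δ| := by
  have h := abs_le.1 hδ
  have h0 : 0 < 1 + δ := by linarith [h.1]
  have h1 := Real.log_le_sub_one_of_pos h0
  have h2 := Real.one_sub_inv_le_log_of_pos h0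
  have h3 : 1 - (1 + δ)⁻¹ = δ / (1 + δ) := by field_simp; ring
  rw [h3] at h2
  have h4 : -(2 * |δ|) ≤ δ / (1 + δ) := by
    rw [le_div_iff₀ h0]
    rcases abs_cases δ with ⟨h5, h6⟩ | ⟨h5, h6⟩ <;> rw [h5] <;> nlinarith [h.1]
  rw [abs_le]
  constructor
  · linarith
  · linarith [le_abs_self δ, abs_nonneg δ]

lemma SecondOrder.increment_bound [IsProbabilityMeasure μ] (hμ : ∀ᵐ x ∂μ, 1 ≤ x) (hρ : ρ < 0) (hU : SecondOrder μ γ ρ A)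
    {x : ℝ} (hx : 0 < x) : ∃ C, ∀ᶠ t in atTop,
      |Real.log (tailQuantile μ (t * x)) - Real.log (tailQuantile μ t) - γ * Real.log x|
        ≤ C * |A t| := by
  have hxγ : 0 < x ^ γ := Real.rpow_pos_of_pos hx _
  set H := x ^ γ * ((x ^ ρ - 1) / ρ)
  -- The factor `2` comes from `|log (1 + δ)| ≤ 2 |δ|`, applied to the relative deviation of
  -- `U(tx)/U(t)` from `x ^ γ`.
  refine ⟨2 * ((|H| + 1) / x ^ γ), ?_⟩
  have hsmall : Tendsto (fun t => |(tailQuantile μ (t * x) / tailQuantile μ t - x ^ γ) / x ^ γ|)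
      atTop (𝓝 0) := by
    simpa using ((hU.tendsto_sub hρ hx).div_const (x ^ γ)).abs
  have htx : Tendsto (fun t : ℝ => t * x) atTop atTop := tendsto_id.atTop_mul_const hx
  filter_upwards [hsmall.eventually_lt_const (show (0 : ℝ) < 1 / 2 by norm_num),
    (hU.2.2 x hx).abs.eventually_lt_const (show |H| < |H| + 1 by linarith),
    hU.eventually_ne hρ, eventually_gt_atTop 1, htx.eventually (eventually_gt_atTop 1)]
    with t h1 h2 hA ht htx1
  have hUt := one_le_tailQuantile hμ ht
  have hUtx := one_le_tailQuantile hμ htx1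
  have h3 := abs_log_one_add_le h1.le
  have h4 : 1 + (tailQuantile μ (t * x) / tailQuantile μ t - x ^ γ) / x ^ γ =
      tailQuantile μ (t * x) / tailQuantile μ t / x ^ γ := by field_simp; ring
  rw [h4, Real.log_div (by positivity) hxγ.ne', Real.log_div (by positivity) (by positivity),
    Real.log_rpow hx] at h3
  refine h3.trans ?_
  rw [abs_div, abs_of_pos hxγ]
  rw [abs_div, div_lt_iff₀ (abs_pos.2 hA)] at h2
  rw [mul_assoc, div_mul_eq_mul_div]
  gcongr

/-- Under the second-order condition `log U` is affine in `log y` up to an error of order `A`,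
with control at all levels `exp w`, `w ≥ 0`. -/
lemma SecondOrder.log_tailQuantile_approx [IsProbabilityMeasure μ] (hμ : ∀ᵐ x ∂μ, 1 ≤ x) (hρ : ρ < 0)
    (hU : SecondOrder μ γ ρ A) :
    ∃ c K M T : ℝ, 0 ≤ K ∧ 0 ≤ M ∧ ∀ u ≥ T, ∀ w ≥ 0,
      |Real.log (tailQuantile μ (Real.exp w)) - γ * w - c|
        ≤ K * |A (Real.exp u)| * (1 + Real.exp (M * (u - w))) := by
  have hexp := Real.tendsto_exp_atTop
  refine exists_limit_with_rate (B := fun u => |A (Real.exp u)|)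
    (η := fun w => Real.log (tailQuantile μ (Real.exp w)) - γ * w) (ρ := ρ) ?_ hρ ?_ ?_ ?_ ?_ ?_
  · exact continuous_abs.measurable.comp (hU.1.comp Real.measurable_exp)
  · filter_upwards [hexp.eventually (hU.eventually_ne hρ)] with u hu
    exact abs_pos.2 hu
  · simpa using (hU.2.1.comp hexp).abs
  · intro v
    have h := ((hU.tendsto_ratio hμ hρ (Real.exp_pos v)).comp hexp).abs
    rw [← Real.exp_mul, abs_of_pos (Real.exp_pos _), mul_comm v] at h
    refine h.congr fun u => ?_
    simp only [Function.comp_apply]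
    rw [abs_div, Real.exp_add]
  · intro v
    obtain ⟨C, hC⟩ := hU.increment_bound hμ hρ (Real.exp_pos v)
    refine ⟨C, ?_⟩
    filter_upwards [hexp.eventually hC] with u hu
    rw [Real.log_exp, ← Real.exp_add] at hu
    convert hu using 2
    ring
  · intro T
    refine ⟨Real.log (tailQuantile μ (Real.exp T)) + |γ| * |T|, fun u hu huT => ?_⟩
    have h1 := log_tailQuantile_exp_nonneg hμ u
    have h2 := log_tailQuantile_exp_mono hμ huT
    have h3 : |γ * u| ≤ |γ| * |T| := by
      rw [abs_mul]
      exact mul_le_mul_of_nonneg_left (abs_le_abs_of_nonneg hu huT) (abs_nonneg _)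
    refine (abs_sub _ _).trans ?_
    rw [abs_of_nonneg h1]
    linarith

end

end BlockQuantile

noncomputable section

namespace BlockQuantile

/-! ### Sorting a tuple is measurable -/

/-- The increasing rearrangement of a tuple. -/
def sortVec {m : ℕ} (x : Fin m → ℝ) : Fin m → ℝ := x ∘ Tuple.sort x

lemma monotone_sortVec {m : ℕ} (x : Fin m → ℝ) : Monotone (sortVec x) := Tuple.monotone_sort x

lemma sortVec_of_monotone {m : ℕ} {x : Fin m → ℝ} (hx : Monotone x) : sortVec x = x := by
  rw [sortVec, Tuple.sort_eq_refl_iff_monotone.2 hx, Equiv.coe_refl, Function.comp_id]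

/-- The monotone rearrangement of a tuple is unique even when `g` creates ties, although the sorting
permutation then is not. -/
lemma sortVec_comp {m : ℕ} {g : ℝ → ℝ} (hg : Monotone g) (x : Fin m → ℝ) :
    sortVec (g ∘ x) = g ∘ sortVec x :=
  Tuple.unique_monotone (f := g ∘ x) (Tuple.monotone_sort _) (hg.comp (Tuple.monotone_sort x))

lemma measurableSet_monotone_comp {m : ℕ} (σ : Fin m → Fin m) :
    MeasurableSet {x : Fin m → ℝ | Monotone (x ∘ σ)} := by
  have : {x : Fin m → ℝ | Monotone (x ∘ σ)} = ⋂ (i) (j) (_ : i ≤ j), {x | x (σ i) ≤ x (σ j)} := by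
    ext x
    simp [Monotone]
  rw [this]
  exact MeasurableSet.iInter fun i => MeasurableSet.iInter fun j => MeasurableSet.iInter fun _ =>
    measurableSet_le (measurable_pi_apply _) (measurable_pi_apply _)

/-- `Tuple.sort` breaks ties by index, so `σ` is characterized by sorting `x` and being increasing
on ties: finitely many comparisons of coordinates. -/
lemma measurableSet_sort_eq {m : ℕ} (σ : Equiv.Perm (Fin m)) :
    MeasurableSet {x : Fin m → ℝ | Tuple.sort x = σ} := by
  have : {x : Fin m → ℝ | Tuple.sort x = σ} = {x : Fin m → ℝ | Monotone (x ∘ σ)} ∩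
      ⋂ (i) (j) (_ : i < j) (_ : ¬ σ i < σ j), {x | x (σ i) = x (σ j)}ᶜ := by
    ext x
    simp only [Set.mem_ofPred_eq, eq_comm (a := Tuple.sort x), Tuple.eq_sort_iff, Set.mem_inter_iff,
      Set.mem_iInter, Set.mem_compl_iff]
    refine and_congr_right fun _ => forall_congr' fun i => forall_congr' fun j => ?_
    tauto
  rw [this]
  refine (measurableSet_monotone_comp σ).inter ?_
  exact MeasurableSet.iInter fun i => MeasurableSet.iInter fun j => MeasurableSet.iInter fun _ =>
    MeasurableSet.iInter fun _ =>
    (measurableSet_eq_fun (measurable_pi_apply (σ i)) (measurable_pi_apply (σ j))).compl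

lemma measurable_sortVec (m : ℕ) : Measurable (sortVec : (Fin m → ℝ) → Fin m → ℝ) := by
  classical
  refine measurable_pi_lambda _ fun k => ?_
  have : (fun x : Fin m → ℝ => sortVec x k) =
      fun x => ∑ σ : Equiv.Perm (Fin m),
        Set.indicator {y : Fin m → ℝ | Tuple.sort y = σ} (fun y : Fin m → ℝ => y (σ k)) x := by
    ext x
    rw [Finset.sum_eq_single (Tuple.sort x)]
    · simp [sortVec]
    · intro σ _ hσ
      have hx : x ∉ {y : Fin m → ℝ | Tuple.sort y = σ} := fun h => hσ (Eq.symm h)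
      exact Set.indicator_of_notMem hx (fun y => y (σ k))
    · simp
  rw [this]
  exact Finset.measurable_sum _ fun σ _ =>
    (measurable_pi_apply _).indicator (measurableSet_sort_eq σ)

lemma orderStat_eq_sortVec {N : ℕ} (x : Fin N → ℝ) {j : ℕ} (h : 1 ≤ j ∧ j ≤ N) :
    orderStat x j = sortVec x ⟨N - j, by omega⟩ := by
  rw [orderStat, dif_pos h]
  rfl

lemma orderStat_sortVec {N : ℕ} (x : Fin N → ℝ) (j : ℕ) :
    orderStat (sortVec x) j = orderStat x j := by
  by_cases h : 1 ≤ j ∧ j ≤ N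
  · rw [orderStat_eq_sortVec _ h, orderStat_eq_sortVec _ h,
      sortVec_of_monotone (monotone_sortVec x)]
  · rw [orderStat, orderStat, dif_neg h, dif_neg h]

lemma measurable_orderStat {N : ℕ} (j : ℕ) : Measurable fun x : Fin N → ℝ => orderStat x j := by
  by_cases h : 1 ≤ j ∧ j ≤ N
  · simp only [orderStat_eq_sortVec _ h]
    exact (measurable_pi_apply _).comp (measurable_sortVec N)
  · simp only [orderStat, dif_neg h]
    exact measurable_const

/-! ### Increasing rearrangement of an exchangeable vector without ties -/

lemma volume_not_injective (m : ℕ) : volume {x : Fin m → ℝ | ¬ Function.Injective x} = 0 := by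
  have hsub : {x : Fin m → ℝ | ¬ Function.Injective x} ⊆
      ⋃ (i) (j) (_ : i ≠ j), {x | x i = x j} := by
    intro x hx
    obtain ⟨i, j, h, hij⟩ : ∃ i j, x i = x j ∧ i ≠ j := by
      simpa [Function.Injective] using hx
    simp only [Set.mem_iUnion]
    exact ⟨i, j, hij, h⟩
  refine measure_mono_null hsub ?_
  refine measure_iUnion_null fun i => measure_iUnion_null fun j => measure_iUnion_null fun hij => ?_
  set S : Submodule ℝ (Fin m → ℝ) := LinearMap.ker
    (LinearMap.proj (R := ℝ) (φ := fun _ : Fin m => ℝ) i - LinearMap.proj j)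
  have hS : {x : Fin m → ℝ | x i = x j} = S := by
    ext x
    simp [S, sub_eq_zero]
  rw [hS]
  refine Measure.addHaar_submodule _ _ fun htop => ?_
  have : Pi.single i (1 : ℝ) ∈ S := htop ▸ Submodule.mem_top
  simp [S, hij.symm] at this

lemma measurePreserving_comp_perm {m : ℕ} (ν : Measure ℝ) [SigmaFinite ν]
    (σ : Equiv.Perm (Fin m)) :
    MeasurePreserving (fun x : Fin m → ℝ => x ∘ σ) (Measure.pi fun _ => ν)
      (Measure.pi fun _ => ν) where
  measurable := measurable_pi_lambda _ fun i => measurable_pi_apply (σ i)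
  map_eq := by
    have hm : Measurable fun x : Fin m → ℝ => x ∘ σ :=
      measurable_pi_lambda _ fun i => measurable_pi_apply (σ i)
    refine (Measure.pi_eq fun s hs => ?_).symm
    rw [Measure.map_apply hm (MeasurableSet.univ_pi hs)]
    have : (fun x : Fin m → ℝ => x ∘ σ) ⁻¹' Set.univ.pi s =
        Set.univ.pi fun i => s (σ.symm i) := by
      ext x
      simp only [Set.mem_preimage, Set.mem_univ_pi, Function.comp_apply]
      exact ⟨fun h i => by simpa using h (σ.symm i), fun h i => by simpa using h (σ i)⟩
    rw [this, Measure.pi_pi]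
    exact Equiv.prod_comp σ.symm fun i => ν (s i)

/-- Up to a factor, the law of the increasing rearrangement of an i.i.d. vector with continuous
law is the law of the vector restricted to the cone of monotone tuples. -/
lemma map_sortVec_pi {m : ℕ} (ν : Measure ℝ) [SigmaFinite ν]
    (hν : (Measure.pi fun _ : Fin m => ν) ≪ volume) :
    (Measure.pi fun _ : Fin m => ν).map sortVec =
      (Fintype.card (Equiv.Perm (Fin m)) : ENNReal) •
        (Measure.pi fun _ => ν).restrict {x | Monotone x} := by
  set P := Measure.pi fun _ : Fin m => ν
  ext s hs
  rw [Measure.map_apply (measurable_sortVec m) hs, Measure.smul_apply, Measure.restrict_apply hs]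
  have hinj : ∀ᵐ x ∂P, Function.Injective x := by
    rw [ae_iff]
    exact hν (volume_not_injective m)
  have hsplit : P (sortVec ⁻¹' s) =
      ∑ σ : Equiv.Perm (Fin m), P (sortVec ⁻¹' s ∩ {x | Tuple.sort x = σ}) := by
    rw [← measure_biUnion_finset]
    · congr 1
      ext x
      simp
    · intro σ _ τ _ hστ
      refine Set.disjoint_left.2 fun x hx hx' => hστ (hx.2.symm.trans hx'.2)
    · exact fun σ _ => (measurable_sortVec m hs).inter (measurableSet_sort_eq σ)
  -- Without ties, `Tuple.sort x = σ` exactly when `x ∘ σ` is monotone, so each piece is the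
  -- preimage of `s ∩ {Monotone}` under a measure-preserving permutation of coordinates.
  have hpiece : ∀ σ : Equiv.Perm (Fin m), P (sortVec ⁻¹' s ∩ {x | Tuple.sort x = σ}) =
      P (s ∩ {x | Monotone x}) := by
    intro σ
    have hm : MeasurableSet {x : Fin m → ℝ | Monotone x} := measurableSet_monotone_comp id
    rw [← (measurePreserving_comp_perm ν σ).measure_preimage (hs.inter hm).nullMeasurableSet]
    refine measure_congr ?_
    filter_upwards [hinj] with x hx
    apply propext
    change sortVec x ∈ s ∧ Tuple.sort x = σ ↔ x ∘ σ ∈ s ∧ Monotone (x ∘ σ)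
    constructor
    · rintro ⟨h1, rfl⟩
      exact ⟨h1, Tuple.monotone_sort x⟩
    · rintro ⟨h1, h2⟩
      have h3 : σ = Tuple.sort x := by
        rw [Tuple.eq_sort_iff]
        refine ⟨h2, fun i j hij h => ?_⟩
        exact absurd (σ.injective (hx h)) hij.ne
      subst h3
      exact ⟨h1, rfl⟩
  rw [hsplit, Finset.sum_congr rfl fun σ _ => hpiece σ]
  simp [smul_eq_mul]

/-! ### Rényi's representation of exponential order statistics -/

lemma lintegral_pi_prod : ∀ {n : ℕ} {f : Fin n → ℝ → ENNReal} (_ : ∀ i, Measurable (f i)),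
    ∫⁻ x : Fin n → ℝ, ∏ i, f i (x i) = ∏ i, ∫⁻ x, f i x := by
  intro n
  induction n with
  | zero => intro f _; simp [volume_pi]
  | succ n ih =>
    intro f hf
    rw [← (volume_preserving_piFinSuccAbove (fun _ : Fin (n + 1) => ℝ) 0).symm.lintegral_comp_emb
      (MeasurableEquiv.measurableEmbedding _), Fin.prod_univ_succ, ← ih fun i => hf i.succ,
      Measure.volume_eq_prod, ← lintegral_prod_mul (hf 0).aemeasurable
      (Finset.measurable_prod _ fun i _ =>
        (hf i.succ).comp (measurable_pi_apply i)).aemeasurable]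
    refine lintegral_congr fun z => ?_
    simp [MeasurableEquiv.piFinSuccAbove, Fin.prod_univ_succ]

/-- The density of a vector of independent standard exponential variables. -/
lemma pi_expMeasure (m : ℕ) : (Measure.pi fun _ : Fin m => expMeasure 1) =
    volume.withDensity fun x => ∏ i, exponentialPDF 1 (x i) := by
  have := isProbabilityMeasure_expMeasure one_pos
  have hpdf : Measurable (exponentialPDF 1) :=
    (measurable_exponentialPDFReal 1).ennreal_ofReal
  refine Measure.pi_eq fun s hs => ?_
  rw [withDensity_apply _ (MeasurableSet.univ_pi hs), ← lintegral_indicator (MeasurableSet.univ_pi hs)]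
  have : ∀ i, expMeasure 1 (s i) = ∫⁻ x, (s i).indicator (exponentialPDF 1) x := by
    intro i
    rw [lintegral_indicator (hs i)]
    exact withDensity_apply _ (hs i)
  simp only [this]
  rw [← lintegral_pi_prod fun i => hpdf.indicator (hs i)]
  refine lintegral_congr fun x => ?_
  by_cases hx : x ∈ Set.univ.pi s
  · rw [Set.indicator_of_mem hx]
    exact Finset.prod_congr rfl fun i _ => (Set.indicator_of_mem (hx i trivial) _).symm
  · rw [Set.indicator_of_notMem hx]
    obtain ⟨i, hi⟩ : ∃ i, x i ∉ s i := by simpa [Set.mem_univ_pi] using hx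
    exact (Finset.prod_eq_zero (Finset.mem_univ i) (Set.indicator_of_notMem hi _)).symm

lemma prod_exponentialPDF_of_nonneg {m : ℕ} {x : Fin m → ℝ} (hx : ∀ i, 0 ≤ x i) :
    ∏ i, exponentialPDF 1 (x i) = ENNReal.ofReal (Real.exp (-∑ i, x i)) := by
  rw [← Finset.sum_neg_distrib, Real.exp_sum,
    ENNReal.ofReal_prod_of_nonneg fun i _ => (Real.exp_pos _).le]
  refine Finset.prod_congr rfl fun i _ => ?_
  rw [exponentialPDF_of_nonneg (hx i)]
  simp

lemma prod_exponentialPDF_of_neg {m : ℕ} {x : Fin m → ℝ} {i : Fin m} (hx : x i < 0) :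
    ∏ i, exponentialPDF 1 (x i) = 0 :=
  Finset.prod_eq_zero (Finset.mem_univ i) (exponentialPDF_of_neg hx)

/-- The matrix of normalized spacings. -/
def renyiMatrix (m : ℕ) : Matrix (Fin m) (Fin m) ℝ :=
  fun k l => if l ≤ k then 1 / ((m : ℝ) - l) else 0

/-- The vector of normalized partial sums `∑_{l ≤ k} z l / (m - l)`. -/
def renyiVec {m : ℕ} (z : Fin m → ℝ) (k : Fin m) : ℝ :=
  ∑ l ∈ Finset.Iic k, z l / ((m : ℝ) - l)

lemma toLin'_renyiMatrix {m : ℕ} (z : Fin m → ℝ) :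
    Matrix.toLin' (renyiMatrix m) z = renyiVec z := by
  ext k
  rw [Matrix.toLin'_apply, Matrix.mulVec, dotProduct, renyiVec, ← Finset.filter_ge_eq_Iic,
    Finset.sum_filter]
  refine Finset.sum_congr rfl fun l _ => ?_
  simp only [renyiMatrix]
  split_ifs <;> ring

lemma sub_pos_of_fin {m : ℕ} (l : Fin m) : (0 : ℝ) < (m : ℝ) - l := by
  have := l.2
  rw [sub_pos]
  exact_mod_cast this

lemma det_renyiMatrix_ne_zero (m : ℕ) : (renyiMatrix m).det ≠ 0 := by
  rw [Matrix.det_of_isLowerTriangular]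
  · refine Finset.prod_ne_zero_iff.2 fun k _ => ?_
    simp only [renyiMatrix, le_refl, if_true]
    exact (one_div_pos.2 (sub_pos_of_fin k)).ne'
  · intro i j hij
    exact if_neg (not_le.2 hij)

lemma measurable_renyiVec (m : ℕ) : Measurable (renyiVec : (Fin m → ℝ) → Fin m → ℝ) := by
  unfold renyiVec
  fun_prop

/-- Each `z l` occurs in `m - l` partial sums with weight `1 / (m - l)`. As the exponential density
depends only on the sum of the coordinates, it is unchanged by `renyiVec`. -/
lemma sum_renyiVec {m : ℕ} (z : Fin m → ℝ) : ∑ k, renyiVec z k = ∑ l, z l := by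
  simp only [renyiVec, ← Finset.filter_ge_eq_Iic, Finset.sum_filter]
  rw [Finset.sum_comm]
  refine Finset.sum_congr rfl fun l _ => ?_
  rw [← Finset.sum_filter, Finset.filter_le_eq_Ici, Finset.sum_const, Fin.card_Ici, nsmul_eq_mul,
    Nat.cast_sub l.2.le]
  field_simp [(sub_pos_of_fin l).ne']

lemma monotone_renyiVec {m : ℕ} {z : Fin m → ℝ} (hz : ∀ l, 0 ≤ z l) : Monotone (renyiVec z) :=
  fun _ _ hab => Finset.sum_le_sum_of_subset_of_nonneg (Finset.Iic_subset_Iic.2 hab)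
    fun l _ _ => div_nonneg (hz l) (sub_pos_of_fin l).le

lemma renyiVec_nonneg {m : ℕ} {z : Fin m → ℝ} (hz : ∀ l, 0 ≤ z l) (k : Fin m) :
    0 ≤ renyiVec z k :=
  Finset.sum_nonneg fun l _ => div_nonneg (hz l) (sub_pos_of_fin l).le

/-- The first entry and the successive differences of `renyiVec z` are the `z l / (m - l)`; so the
nonnegative orthant is exactly the preimage of the nonnegative monotone tuples. -/
lemma nonneg_of_monotone_renyiVec {m : ℕ} {z : Fin m → ℝ} (hmono : Monotone (renyiVec z))
    (h0 : ∀ k, 0 ≤ renyiVec z k) (l : Fin m) : 0 ≤ z l := by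
  have hdiv : 0 ≤ z l / ((m : ℝ) - l) := by
    obtain ⟨n, rfl⟩ : ∃ n, m = n + 1 := ⟨m - 1, by have := l.2; omega⟩
    cases l using Fin.cases with
    | zero =>
      have h := h0 0
      have hI : Finset.Iic (0 : Fin (n + 1)) = {0} := by
        ext i; simp
      rwa [renyiVec, hI, Finset.sum_singleton] at h
    | succ l =>
      have h := hmono l.castSucc_le_succ
      have hI : Finset.Iic l.succ = insert l.succ (Finset.Iic l.castSucc) := by
        ext i
        simp only [Finset.mem_Iic, Finset.mem_insert, Fin.le_def, Fin.ext_iff, Fin.val_succ,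
          Fin.val_castSucc]
        omega
      rw [renyiVec, renyiVec, hI, Finset.sum_insert (by simp [Fin.le_def])] at h
      linarith
  have := mul_nonneg hdiv (sub_pos_of_fin l).le
  rwa [div_mul_cancel₀ _ (sub_pos_of_fin l).ne'] at this

lemma prod_exponentialPDF_renyiVec {m : ℕ} (z : Fin m → ℝ) :
    ∏ i, exponentialPDF 1 (z i) = {x : Fin m → ℝ | Monotone x}.indicator
      (fun x => ∏ i, exponentialPDF 1 (x i)) (renyiVec z) := by
  by_cases hz : ∀ l, 0 ≤ z l
  · rw [Set.indicator_of_mem (monotone_renyiVec hz), prod_exponentialPDF_of_nonneg hz,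
      prod_exponentialPDF_of_nonneg (renyiVec_nonneg hz), sum_renyiVec]
  · obtain ⟨l, hl⟩ := not_forall.1 hz
    rw [prod_exponentialPDF_of_neg (not_le.1 hl)]
    by_cases hm : Monotone (renyiVec z)
    · rw [Set.indicator_of_mem hm]
      have : ¬ ∀ k, 0 ≤ renyiVec z k := fun h0 => hl (nonneg_of_monotone_renyiVec hm h0 l)
      obtain ⟨k, hk⟩ := not_forall.1 this
      exact (prod_exponentialPDF_of_neg (not_le.1 hk)).symm
    · exact (Set.indicator_of_notMem hm _).symm

/-- A linear change of variables has constant Jacobian. Its value is not needed, since comparing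
total masses will fix the constant. -/
lemma map_renyiVec_pi (m : ℕ) : ∃ c : ENNReal,
    (Measure.pi fun _ : Fin m => expMeasure 1).map renyiVec =
      c • (Measure.pi fun _ => expMeasure 1).restrict {x | Monotone x} := by
  refine ⟨ENNReal.ofReal |(renyiMatrix m).det⁻¹|, ?_⟩
  have hlin : (⇑(Matrix.toLin' (renyiMatrix m)) : (Fin m → ℝ) → Fin m → ℝ) = renyiVec :=
    funext toLin'_renyiMatrix
  have hvol := Real.map_matrix_volume_pi_eq_smul_volume_pi (det_renyiMatrix_ne_zero m)
  rw [hlin] at hvol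
  have hm : MeasurableSet {x : Fin m → ℝ | Monotone x} := measurableSet_monotone_comp id
  have hpdf : Measurable (exponentialPDF 1) :=
    (measurable_exponentialPDFReal 1).ennreal_ofReal
  have hprod : Measurable fun x : Fin m → ℝ => ∏ i, exponentialPDF 1 (x i) := by fun_prop
  ext s hs
  rw [pi_expMeasure, Measure.map_apply (measurable_renyiVec m) hs,
    withDensity_apply _ (measurable_renyiVec m hs), Measure.smul_apply, Measure.restrict_apply hs,
    withDensity_apply _ (hs.inter hm)]
  rw [lintegral_congr prod_exponentialPDF_renyiVec, ← setLIntegral_map hs (hprod.indicator hm) (measurable_renyiVec m), hvol,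
    Measure.restrict_smul, lintegral_smul_measure, lintegral_indicator hm,
    Measure.restrict_restrict hm, Set.inter_comm]

/-- **Rényi's representation**: the increasing rearrangement of `m` independent standard
exponential variables has the law of the partial sums of independent exponential spacings. -/
theorem map_sortVec_eq_map_renyiVec (m : ℕ) :
    (Measure.pi fun _ : Fin m => expMeasure 1).map sortVec =
      (Measure.pi fun _ : Fin m => expMeasure 1).map renyiVec := by
  have := isProbabilityMeasure_expMeasure one_pos
  set P := Measure.pi fun _ : Fin m => expMeasure 1
  have hac : P ≪ volume := by
    simp only [P, pi_expMeasure]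
    exact withDensity_absolutelyContinuous _ _
  obtain ⟨c, hc⟩ := map_renyiVec_pi m
  have hs := map_sortVec_pi (expMeasure 1) hac
  have h1 := Measure.isProbabilityMeasure_map (μ := P) (measurable_sortVec m).aemeasurable
  have h2 := Measure.isProbabilityMeasure_map (μ := P) (measurable_renyiVec m).aemeasurable
  have h1u := h1.measure_univ
  have h2u := h2.measure_univ
  rw [hs, Measure.smul_apply, smul_eq_mul] at h1u
  rw [hc, Measure.smul_apply, smul_eq_mul] at h2u
  rw [hs, hc]
  congr 1
  -- With `v` the mass of the monotone cone and `N` the number of permutations, `N v = 1 = c v`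
  -- gives `N = N (c v) = c (N v) = c`, with no division in `ENNReal`.
  rw [← mul_one (Fintype.card (Equiv.Perm (Fin m)) : ENNReal), ← h2u, mul_left_comm, h1u, mul_one]

end BlockQuantile

end

noncomputable section

namespace BlockQuantile

/-! ### Joint law of the sorted blocks -/

/-- A doubly indexed i.i.d. family, viewed as a family of blocks, has the product law. -/
lemma map_blocks_eq_pi {Ω : Type*} [MeasurableSpace Ω] {P : Measure Ω} {ν : Measure ℝ}
    [IsProbabilityMeasure ν] {k : ℕ} {m : Fin k → ℕ} {X : (i : Fin k) → Fin (m i) → Ω → ℝ}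
    (hlaw : ∀ i l, HasLaw (X i l) ν P)
    (hindep : iIndepFun (fun s : (i : Fin k) × Fin (m i) => X s.1 s.2) P) :
    P.map (fun ω i l => X i l ω) = Measure.pi fun i => Measure.pi fun _ : Fin (m i) => ν := by
  have hae : AEMeasurable (fun ω (s : (i : Fin k) × Fin (m i)) => X s.1 s.2 ω) P :=
    aemeasurable_pi_lambda _ fun s => (hlaw s.1 s.2).aemeasurable
  have h := (hindep.hasLaw_infinitePi
    (fun s : (i : Fin k) × Fin (m i) => hlaw s.1 s.2) hae).map_eq
  have hc := Measure.infinitePi_map_piCurry (X := fun (i : Fin k) (_ : Fin (m i)) => ℝ)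
    (fun _ _ => ν)
  rw [← h, AEMeasurable.map_map_of_aemeasurable (by fun_prop) hae, Measure.infinitePi_eq_pi] at hc
  simp only [Measure.infinitePi_eq_pi] at hc
  exact hc

/-- The sorted blocks of an i.i.d. array with law `μ` have the joint law obtained by inserting
Rényi's exponential representation into the quantile transform. -/
lemma identDistrib_sortVec_renyiVec {μ : Measure ℝ} [IsProbabilityMeasure μ]
    (hμ : ∀ᵐ x ∂μ, 1 ≤ x) {Ω Ω' : Type*} [MeasurableSpace Ω] [MeasurableSpace Ω'] {P : Measure Ω}
    {P' : Measure Ω'} {k : ℕ} {m : Fin k → ℕ} {X : (i : Fin k) → Fin (m i) → Ω → ℝ}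
    {Z : (i : Fin k) → Fin (m i) → Ω' → ℝ}
    (hX : ∀ i l, HasLaw (X i l) μ P)
    (hXi : iIndepFun (fun s : (i : Fin k) × Fin (m i) => X s.1 s.2) P)
    (hZ : ∀ i l, HasLaw (Z i l) (expMeasure 1) P')
    (hZi : iIndepFun (fun s : (i : Fin k) × Fin (m i) => Z s.1 s.2) P') :
    IdentDistrib (fun ω i => sortVec fun l => X i l ω)
      (fun ω i j => tailQuantile μ (Real.exp (renyiVec (fun l => Z i l ω) j))) P P' := by
  have := isProbabilityMeasure_expMeasure one_pos
  set g : ℝ → ℝ := fun e => tailQuantile μ (Real.exp e)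
  have hg : Monotone g := monotone_tailQuantile_exp hμ
  have hgm : Measurable g := hg.measurable
  have hXm : AEMeasurable (fun ω i l => X i l ω) P :=
    aemeasurable_pi_lambda _ fun i => aemeasurable_pi_lambda _ fun l => (hX i l).aemeasurable
  have hZm : AEMeasurable (fun ω i l => Z i l ω) P' :=
    aemeasurable_pi_lambda _ fun i => aemeasurable_pi_lambda _ fun l => (hZ i l).aemeasurable
  have hgv : ∀ n, Measurable fun x : Fin n → ℝ => g ∘ x := fun n =>
    measurable_pi_lambda _ fun l => hgm.comp (measurable_pi_apply l)
  have hR : ∀ n, Measurable fun z : Fin n → ℝ => g ∘ renyiVec z := fun n =>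
    (hgv n).comp (measurable_renyiVec n)
  have hS : Measurable fun (x : (i : Fin k) → Fin (m i) → ℝ) i => sortVec (x i) :=
    measurable_pi_lambda _ fun i => (measurable_sortVec _).comp (measurable_pi_apply i)
  have hT : Measurable fun (z : (i : Fin k) → Fin (m i) → ℝ) i => g ∘ renyiVec (z i) :=
    measurable_pi_lambda _ fun i => (hR _).comp (measurable_pi_apply i)
  refine ⟨hS.comp_aemeasurable hXm, hT.comp_aemeasurable hZm, ?_⟩
  -- Sorting commutes with the monotone transform `g`, so the exponential representation passes
  -- through the quantile transform.
  have hblock : ∀ n : ℕ, (Measure.pi fun _ : Fin n => μ).map sortVec =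
      (Measure.pi fun _ : Fin n => expMeasure 1).map fun z => g ∘ renyiVec z := by
    intro n
    have h1 : (Measure.pi fun _ : Fin n => μ) =
        (Measure.pi fun _ : Fin n => expMeasure 1).map fun x => g ∘ x := by
      have hge : (expMeasure 1).map g = μ := (hasLaw_tailQuantile_exp hμ).map_eq
      have : SigmaFinite ((expMeasure 1).map g) := by rw [hge]; infer_instance
      have h2 := Measure.pi_map_pi (μ := fun _ : Fin n => expMeasure 1) (f := fun _ => g)
        fun _ => hgm.aemeasurable
      rw [hge] at h2
      exact h2.symm
    have h3 : (sortVec ∘ fun x : Fin n → ℝ => g ∘ x) = (fun x => g ∘ x) ∘ sortVec :=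
      funext fun x => sortVec_comp hg x
    have h4 : (fun z : Fin n → ℝ => g ∘ renyiVec z) = (fun x => g ∘ x) ∘ renyiVec := rfl
    rw [h1, Measure.map_map (measurable_sortVec n) (hgv n), h3, h4,
      ← Measure.map_map (hgv n) (measurable_sortVec n), map_sortVec_eq_map_renyiVec,
      Measure.map_map (hgv n) (measurable_renyiVec n)]
  have hSP : ∀ n, IsProbabilityMeasure ((Measure.pi fun _ : Fin n => μ).map sortVec) := fun n =>
    Measure.isProbabilityMeasure_map (measurable_sortVec n).aemeasurable
  have hTP : ∀ n, IsProbabilityMeasure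
      ((Measure.pi fun _ : Fin n => expMeasure 1).map fun z => g ∘ renyiVec z) := fun n =>
    Measure.isProbabilityMeasure_map (hR n).aemeasurable
  have hl : P.map (fun ω i => sortVec fun l => X i l ω) =
      Measure.pi fun i => (Measure.pi fun _ : Fin (m i) => μ).map sortVec := by
    rw [← Measure.pi_map_pi fun i => (measurable_sortVec (m i)).aemeasurable,
      ← map_blocks_eq_pi hX hXi, AEMeasurable.map_map_of_aemeasurable hS.aemeasurable hXm]
    rfl
  have hr : P'.map (fun ω i => g ∘ renyiVec fun l => Z i l ω) =
      Measure.pi fun i => (Measure.pi fun _ : Fin (m i) => expMeasure 1).map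
        fun z => g ∘ renyiVec z := by
    rw [← Measure.pi_map_pi fun i => (hR (m i)).aemeasurable,
      ← map_blocks_eq_pi hZ hZi, AEMeasurable.map_map_of_aemeasurable hT.aemeasurable hZm]
    rfl
  rw [hl]
  simp only [hblock]
  exact hr.symm

/-! ### Moments of the standard exponential law -/

lemma integral_expMeasure (f : ℝ → ℝ) :
    ∫ x, f x ∂(expMeasure 1) = ∫ x in Set.Ioi 0, Real.exp (-x) * f x := by
  have hpdf : Measurable (exponentialPDF 1) :=
    (measurable_exponentialPDFReal 1).ennreal_ofReal
  have h := integral_withDensity_eq_integral_toReal_smul (μ := volume) hpdf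
    (ae_of_all _ fun x => ENNReal.ofReal_lt_top) f
  change ∫ x, f x ∂(volume.withDensity (exponentialPDF 1)) = _
  rw [h, ← integral_Ici_eq_integral_Ioi, ← integral_indicator measurableSet_Ici]
  refine integral_congr_ae (ae_of_all _ fun x => ?_)
  by_cases hx : 0 ≤ x
  · simp [Set.indicator_of_mem (Set.mem_Ici.2 hx), exponentialPDF_of_nonneg hx,
      ENNReal.toReal_ofReal (Real.exp_pos _).le]
  · rw [Set.indicator_of_notMem (by simpa using hx)]
    simp [exponentialPDF_of_neg (not_le.1 hx)]

lemma integrable_expMeasure_iff {f : ℝ → ℝ} :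
    Integrable f (expMeasure 1) ↔ IntegrableOn (fun x => Real.exp (-x) * f x) (Set.Ioi 0) := by
  have hpdf : Measurable (exponentialPDF 1) :=
    (measurable_exponentialPDFReal 1).ennreal_ofReal
  change Integrable f (volume.withDensity (exponentialPDF 1)) ↔ _
  rw [integrable_withDensity_iff_integrable_smul' hpdf
    (ae_of_all _ fun x => ENNReal.ofReal_lt_top), ← integrableOn_Ici_iff_integrableOn_Ioi,
    ← integrable_indicator_iff measurableSet_Ici]
  refine integrable_congr (ae_of_all _ fun x => ?_)
  by_cases hx : 0 ≤ x
  · simp [Set.indicator_of_mem (Set.mem_Ici.2 hx), exponentialPDF_of_nonneg hx,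
      ENNReal.toReal_ofReal (Real.exp_pos _).le]
  · rw [Set.indicator_of_notMem (by simpa using hx)]
    simp [exponentialPDF_of_neg (not_le.1 hx)]

lemma integral_pow_expMeasure (n : ℕ) : ∫ x, x ^ n ∂(expMeasure 1) = n.factorial := by
  rw [integral_expMeasure, ← Real.Gamma_nat_eq_factorial, Real.Gamma_eq_integral (by positivity)]
  simp

lemma integrable_pow_expMeasure (n : ℕ) : Integrable (fun x => x ^ n) (expMeasure 1) := by
  rw [integrable_expMeasure_iff]
  have := Real.GammaIntegral_convergent (s := n + 1) (by positivity)
  simpa using this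

lemma memLp_two_expMeasure : MemLp id 2 (expMeasure 1) :=
  (memLp_two_iff_integrable_sq (by fun_prop)).2 (integrable_pow_expMeasure 2)

lemma integral_id_expMeasure : ∫ x, x ∂(expMeasure 1) = 1 := by
  simpa using integral_pow_expMeasure 1

lemma variance_id_expMeasure : Var[id; expMeasure 1] = 1 := by
  have := isProbabilityMeasure_expMeasure one_pos
  rw [variance_eq_sub memLp_two_expMeasure]
  have h := integral_pow_expMeasure 2
  simp only [Pi.pow_apply, id, integral_id_expMeasure, h]
  norm_num [Nat.factorial]

lemma integral_exp_neg_mul_expMeasure {s : ℝ} (hs : 0 ≤ s) :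
    ∫ x, Real.exp (-(s * x)) ∂(expMeasure 1) = 1 / (1 + s) := by
  rw [integral_expMeasure]
  have h := integral_exp_mul_Ioi (a := -(1 + s)) (by linarith) 0
  simp only [mul_zero, Real.exp_zero] at h
  rw [show (1 : ℝ) / (1 + s) = -1 / (-(1 + s)) by rw [neg_div_neg_eq], ← h]
  refine integral_congr_ae (ae_of_all _ fun x => ?_)
  simp only [← Real.exp_add]
  congr 1
  ring

lemma ae_nonneg_expMeasure : ∀ᵐ x ∂(expMeasure 1), 0 ≤ x := by
  have := isProbabilityMeasure_expMeasure one_pos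
  have h : expMeasure 1 (Set.Iic 0) = 0 := by
    rw [← ofReal_cdf, cdf_expMeasure_eq one_pos]
    simp
  rw [ae_iff]
  exact measure_mono_null (fun x hx => (not_le.1 hx).le) h

end BlockQuantile

end

noncomputable section

namespace BlockQuantile

/-! ### Limit theorems for independent exponential variables -/

/-- Markov's inequality, applied to an integrable majorant. -/
lemma tendstoInMeasure_zero_of_integral_le {Ω : Type*} [MeasurableSpace Ω] {P : Measure Ω}
    [IsFiniteMeasure P] {f : ℕ → Ω → ℝ} {b : ℕ → ℝ} (hb : Tendsto b atTop (𝓝 0))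
    (h : ∀ᶠ n in atTop, ∃ D : Ω → ℝ, Integrable D P ∧ (∀ᵐ ω ∂P, |f n ω| ≤ D ω) ∧ ∫ ω, D ω ∂P ≤ b n) :
    TendstoInMeasure P f atTop fun _ => 0 := by
  rw [tendstoInMeasure_iff_measureReal_norm]
  intro ε hε
  refine squeeze_zero' (Eventually.of_forall fun n => measureReal_nonneg)
    (g := fun n => b n / ε) ?_ (by simpa using hb.div_const ε)
  filter_upwards [h] with n ⟨D, hD, hfD, hint⟩
  rw [le_div_iff₀ hε, mul_comm]
  have hD0 : 0 ≤ᵐ[P] D := hfD.mono fun ω hω => (abs_nonneg _).trans hω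
  refine le_trans ?_ ((mul_meas_ge_le_integral_of_nonneg hD0 hD ε).trans hint)
  refine mul_le_mul_of_nonneg_left ?_ hε.le
  refine ENNReal.toReal_mono (measure_ne_top P _) (measure_mono_ae ?_)
  filter_upwards [hfD] with ω hω hω'
  have hω'' : ε ≤ ‖f n ω - 0‖ := hω'
  rw [sub_zero, Real.norm_eq_abs] at hω''
  exact hω''.trans hω

section

variable {ι Ω : Type*} [MeasurableSpace Ω] {P : Measure Ω} {Y : ι → Ω → ℝ}

lemma memLp_two_of_hasLaw_exp (hY : ∀ s, HasLaw (Y s) (expMeasure 1) P) (s : ι) :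
    MemLp (Y s) 2 P := by
  have h := memLp_two_expMeasure
  rw [← (hY s).map_eq, memLp_map_measure_iff (by fun_prop) (hY s).aemeasurable] at h
  exact h

lemma integral_of_hasLaw_exp (hY : ∀ s, HasLaw (Y s) (expMeasure 1) P) (s : ι) :
    ∫ ω, Y s ω ∂P = 1 := by
  rw [(hY s).integral_eq, integral_id_expMeasure]

/-- `L¹` bound for weighted sums of centred independent exponential variables. -/
lemma integral_abs_sum_le [IsProbabilityMeasure P] (hY : ∀ s, HasLaw (Y s) (expMeasure 1) P)
    (hi : iIndepFun Y P) (c : ι → ℝ) (S : Finset ι) :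
    Integrable (fun ω => ∑ s ∈ S, c s * (Y s ω - 1)) P ∧
      ∫ ω, |∑ s ∈ S, c s * (Y s ω - 1)| ∂P ≤ Real.sqrt (∑ s ∈ S, c s ^ 2) := by
  set V : ι → Ω → ℝ := fun s ω => c s * (Y s ω - 1)
  have hV : ∀ s, MemLp (V s) 2 P := fun s =>
    ((memLp_two_of_hasLaw_exp hY s).sub (memLp_const 1)).const_mul (c s)
  have hVs : MemLp (∑ s ∈ S, V s) 2 P := memLp_finsetSum' S fun s _ => hV s
  have hVeq : (fun ω => ∑ s ∈ S, c s * (Y s ω - 1)) = ∑ s ∈ S, V s := by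
    ext ω; simp [V]
  have hVi : iIndepFun V P := hi.comp (fun s y => c s * (y - 1)) fun s => by fun_prop
  have hYint : ∀ s, Integrable (Y s) P := fun s =>
    (memLp_two_of_hasLaw_exp hY s).integrable one_le_two
  have hmean : ∀ s, ∫ ω, V s ω ∂P = 0 := by
    intro s
    simp only [V]
    rw [integral_const_mul, integral_sub (hYint s) (integrable_const 1),
      integral_of_hasLaw_exp hY s]
    simp
  have hvar : ∀ s, Var[V s; P] = c s ^ 2 := by
    intro s
    simp only [V]
    rw [variance_const_mul, variance_sub_const (hY s).aemeasurable.aestronglyMeasurable,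
      (hY s).variance_eq, variance_id_expMeasure, mul_one]
  have htot : Var[∑ s ∈ S, V s; P] = ∑ s ∈ S, c s ^ 2 := by
    rw [IndepFun.variance_sum (fun s _ => hV s) fun s _ t _ hst => hVi.indepFun hst]
    exact Finset.sum_congr rfl fun s _ => hvar s
  have hmean' : P[∑ s ∈ S, V s] = 0 := by
    rw [← hVeq, integral_finsetSum _ fun s _ => (hV s).integrable one_le_two]
    exact Finset.sum_eq_zero fun s _ => hmean s
  rw [variance_eq_sub hVs, hmean'] at htot
  set W : Ω → ℝ := |∑ s ∈ S, V s|
  have habs := variance_nonneg W P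
  -- Nonnegativity of the variance of `W` is the inequality `(E W)² ≤ E W²`.
  rw [variance_eq_sub hVs.abs] at habs
  have hsq : P[W ^ 2] = P[(∑ s ∈ S, V s) ^ 2] := by
    refine integral_congr_ae (ae_of_all _ fun ω => ?_)
    simp [W, sq_abs]
  refine ⟨hVeq ▸ hVs.integrable one_le_two, ?_⟩
  refine Real.le_sqrt_of_sq_le ?_
  have hgoal : ∫ ω, |∑ s ∈ S, c s * (Y s ω - 1)| ∂P = P[W] := by
    refine integral_congr_ae (ae_of_all _ fun ω => ?_)
    simp [V, W]
  rw [hgoal]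
  rw [hsq] at habs
  linarith

/-- Laplace transform of a weighted sum of independent exponential variables. -/
lemma integral_exp_neg_sum [IsProbabilityMeasure P] (hY : ∀ s, HasLaw (Y s) (expMeasure 1) P)
    (hi : iIndepFun Y P) {c : ι → ℝ} (hc : ∀ s, 0 ≤ c s) (S : Finset ι) :
    ∫ ω, Real.exp (-∑ s ∈ S, c s * Y s ω) ∂P = ∏ s ∈ S, 1 / (1 + c s) := by
  have h := (hi.comp (fun s y => c s * y) fun s => by fun_prop).mgf_sum₀ (t := -1)
    (fun s => ((hY s).aemeasurable.const_mul (c s))) S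
  have h1 : ∀ s, mgf ((fun y => c s * y) ∘ Y s) P (-1) = 1 / (1 + c s) := by
    intro s
    rw [← integral_exp_neg_mul_expMeasure (hc s),
      ← (hY s).integral_comp (f := fun x => Real.exp (-(c s * x))) (by fun_prop)]
    simp [mgf]
  simp only [h1] at h
  rw [← h]
  simp [mgf]

end

/-- The central limit theorem for row sums of an array of standard exponential variables. -/
lemma tendstoInDistribution_exponential_rows {Ω : Type*} [MeasurableSpace Ω] {P : Measure Ω}
    [IsProbabilityMeasure P] {ι : ℕ → Type*} {Y : ∀ n, ι n → Ω → ℝ}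
    (hY : ∀ n s, HasLaw (Y n s) (expMeasure 1) P) (hi : ∀ n, iIndepFun (Y n) P)
    (S : ∀ n, Finset (ι n)) (hS : Tendsto (fun n => (S n).card) atTop atTop) (γ : ℝ) :
    TendstoInDistribution
      (fun n ω => γ * (Real.sqrt (S n).card)⁻¹ * ∑ s ∈ S n, (Y n s ω - 1)) atTop (id : ℝ → ℝ)
      (fun _ => P) (gaussianReal 0 (γ ^ 2).toNNReal) where
  forall_aemeasurable n :=
    (Finset.aemeasurable_fun_sum _ fun s _ => (hY n s).aemeasurable.sub_const 1).const_mul _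
  tendsto := by
    have hE := isProbabilityMeasure_expMeasure one_pos
    refine ProbabilityMeasure.tendsto_iff_tendsto_charFun.2 fun t => ?_
    have hm : ∀ n s, AEMeasurable (fun ω => Y n s ω - 1) P := fun n s =>
      (hY n s).aemeasurable.sub_const 1
    have hlaw : ∀ n s, P.map (fun ω => Y n s ω - 1) = (expMeasure 1).map fun x => x - 1 := by
      intro n s
      rw [← (hY n s).map_eq, AEMeasurable.map_map_of_aemeasurable (by fun_prop) (hY n s).aemeasurable]
      rfl
    -- All entries of the array share one law, so the characteristic function of a row sum is a
    -- power of a fixed one and the classical limit along `(S n).card` suffices.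
    have hchar : ∀ n, charFun (P.map fun ω => γ * (Real.sqrt (S n).card)⁻¹ *
        ∑ s ∈ S n, (Y n s ω - 1)) t = charFun ((expMeasure 1).map fun x => x - 1)
          ((Real.sqrt (S n).card)⁻¹ * (γ * t)) ^ (S n).card := by
      intro n
      have hind : iIndepFun (fun s ω => Y n s ω - 1) P :=
        (hi n).comp (fun _ y => y - 1) fun _ => by fun_prop
      rw [charFun_map_mul_comp (Finset.aemeasurable_fun_sum _ fun s _ => hm n s),
        (hind.restrict _).charFun_map_fun_finsetSum_eq_prod fun s _ => hm n s]
      simp only [Finset.prod_apply, hlaw, Finset.prod_const]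
      congr 2
      ring
    have h0 : ∫ x, (x - 1) ∂(expMeasure 1) = 0 := by
      have hint : Integrable (fun x : ℝ => x) (expMeasure 1) :=
        memLp_two_expMeasure.integrable one_le_two
      rw [integral_sub hint (integrable_const 1)]
      simp [integral_id_expMeasure]
    have h1 : ∫ x, ((fun x : ℝ => x - 1) ^ 2) x ∂(expMeasure 1) = 1 := by
      have h := variance_eq_integral (X := id) (μ := expMeasure 1) aemeasurable_id
      rw [variance_id_expMeasure] at h
      simpa [integral_id_expMeasure] using h.symm
    have hlim := (tendsto_charFun_inv_sqrt_mul_pow (P := expMeasure 1) (X := fun x => x - 1)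
      (by fun_prop) h0 h1 (γ * t)).comp hS
    have hgauss : charFun ((gaussianReal 0 (γ ^ 2).toNNReal).map (id : ℝ → ℝ)) t =
        Complex.exp (-((γ * t : ℝ) : ℂ) ^ 2 / 2) := by
      rw [Measure.map_id, charFun_gaussianReal]
      congr 1
      rw [Real.coe_toNNReal _ (sq_nonneg γ)]
      push_cast
      ring
    simp only [ProbabilityMeasure.coe_mk]
    rw [hgauss]
    refine hlim.congr fun n => ?_
    simp only [Function.comp_apply, hchar]

end BlockQuantile

end

noncomputable section

namespace BlockQuantile

/-! ### Exponential order statistics as weighted sums of spacings -/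

/-- The `j`-th largest of `m` exponential variables in Rényi's representation. -/
def spacingSum (z : ℕ → ℝ) (m j : ℕ) : ℝ := ∑ l ∈ Finset.Icc j m, z l / l

lemma spacingSum_nonneg {z : ℕ → ℝ} (hz : ∀ l, 0 ≤ z l) (m j : ℕ) : 0 ≤ spacingSum z m j :=
  Finset.sum_nonneg fun l _ => div_nonneg (hz l) (Nat.cast_nonneg l)

lemma spacingSum_antitone {z : ℕ → ℝ} (hz : ∀ l, 0 ≤ z l) (m : ℕ) {i j : ℕ} (hij : i ≤ j) :
    spacingSum z m j ≤ spacingSum z m i :=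
  Finset.sum_le_sum_of_subset_of_nonneg (Finset.Icc_subset_Icc_left hij)
    fun l _ _ => div_nonneg (hz l) (Nat.cast_nonneg l)

lemma spacingSum_eq_add {z : ℕ → ℝ} {m j : ℕ} (h : j ≤ m) :
    spacingSum z m j = z j / j + spacingSum z m (j + 1) := by
  rw [spacingSum, spacingSum, ← Finset.insert_Icc_add_one_left_eq_Icc h, Finset.sum_insert (by simp)]

/-- Ascending position `m - j`, counted from `0`, is descending rank `j`, counted from `1`. Reading
`z` backwards makes the divisor `m - l` equal to the index of the spacing. -/
lemma renyiVec_eq_spacingSum (z : ℕ → ℝ) {m j : ℕ} (h : 1 ≤ j ∧ j ≤ m) :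
    renyiVec (fun l : Fin m => z (m - l)) ⟨m - j, by omega⟩ = spacingSum z m j := by
  rw [renyiVec, spacingSum]
  refine Finset.sum_bij (fun (a : Fin m) _ => m - (a : ℕ)) ?_ ?_ ?_ ?_
  · intro a ha
    have h1 : (a : ℕ) ≤ m - j := by simpa [Fin.le_def] using ha
    simp only [Finset.mem_Icc]
    omega
  · intro a _ b _ hab
    have := a.2
    have := b.2
    ext
    change m - (a : ℕ) = m - (b : ℕ) at hab
    omega
  · intro b hb
    rw [Finset.mem_Icc] at hb
    refine ⟨⟨m - b, by omega⟩, ?_, ?_⟩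
    · simp only [Finset.mem_Iic, Fin.le_def]
      omega
    · change m - (m - b) = b
      omega
  · intro a _
    rw [Nat.cast_sub a.2.le]

lemma orderStat_tailQuantile_renyiVec {μ : Measure ℝ} [IsProbabilityMeasure μ]
    (hμ : ∀ᵐ x ∂μ, 1 ≤ x) {z : ℕ → ℝ} (hz : ∀ l, 0 ≤ z l) {m j : ℕ} (h : 1 ≤ j ∧ j ≤ m) :
    orderStat (fun i => tailQuantile μ (Real.exp (renyiVec (fun l : Fin m => z (m - l)) i))) j =
      tailQuantile μ (Real.exp (spacingSum z m j)) := by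
  have hmono : Monotone fun i =>
      tailQuantile μ (Real.exp (renyiVec (fun l : Fin m => z (m - l)) i)) :=
    (monotone_tailQuantile_exp hμ).comp (monotone_renyiVec fun l => hz _)
  rw [orderStat_eq_sortVec _ h, sortVec_of_monotone hmono, ← renyiVec_eq_spacingSum z h]

/-- The term `z l / l` is counted once for each `j ≤ l`, hence `l` times. This makes the Hill
estimator a plain mean of independent exponentials. -/
lemma sum_spacingSum_sub {z : ℕ → ℝ} {m r : ℕ} (h : r ≤ m) :
    ∑ j ∈ Finset.Icc 1 r, (spacingSum z m j - spacingSum z m (r + 1)) =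
      ∑ l ∈ Finset.Icc 1 r, z l := by
  suffices ∑ j ∈ Finset.Icc 1 r, spacingSum z m j - r * spacingSum z m (r + 1) =
      ∑ l ∈ Finset.Icc 1 r, z l by
    rw [Finset.sum_sub_distrib, Finset.sum_const, Nat.card_Icc, nsmul_eq_mul]
    simpa using this
  induction r with
  | zero => simp
  | succ r ih =>
    rw [Finset.sum_Icc_succ_top (by omega), Finset.sum_Icc_succ_top (by omega), ← ih (by omega),
      spacingSum_eq_add h]
    have : ((r + 1 : ℕ) : ℝ) ≠ 0 := by positivity
    field_simp
    push_cast
    ring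

/-! ### Deterministic decomposition of the estimator -/

section

variable {k : ℕ} (m r : Fin k → ℕ)

/-- The centred weighted average of the intermediate order statistics. -/
def centredLevel (z : Fin k → ℕ → ℝ) : ℝ :=
  (totalR r)⁻¹ * ∑ i, (r i : ℝ) * ∑ l ∈ Finset.Icc (r i + 1) (m i), (z i l - 1) / l

/-- The weighted average of the error factors of the tail approximation. -/
def errorLevel (M u : ℝ) (z : Fin k → ℕ → ℝ) : ℝ :=
  (totalR r)⁻¹ * ∑ i, (r i : ℝ) * (1 + Real.exp (M * (u - spacingSum (z i) (m i) (r i + 1))))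

lemma highQuantile_eq_tailQuantile (μ : Measure ℝ) {p : ℝ} (hp : 0 < p) :
    highQuantile μ p = tailQuantile μ (Real.exp (-Real.log p)) := by
  rw [highQuantile, tailQuantile, Real.exp_neg, Real.exp_log hp, one_div, inv_inv]

variable {m r}

/-- The Hill-type estimator is the mean spacing, up to the error of the tail approximation. -/
lemma abs_gammaHat_sub_le {γ c ε M u : ℝ} {H : ℝ → ℝ} {z : Fin k → ℕ → ℝ}
    {x : (i : Fin k) → Fin (m i) → ℝ} (hM : 0 ≤ M) (hε : 0 ≤ ε) (hz : ∀ i l, 0 ≤ z i l)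
    (hrm : ∀ i, r i + 1 ≤ m i)
    (hH : ∀ w ≥ 0, |H w - γ * w - c| ≤ ε * (1 + Real.exp (M * (u - w))))
    (hx : ∀ i j, 1 ≤ j ∧ j ≤ m i → Real.log (orderStat (x i) j) = H (spacingSum (z i) (m i) j)) :
    |gammaHat r x - γ * ((totalR r)⁻¹ * ∑ i, ∑ l ∈ Finset.Icc 1 (r i), z i l)| ≤
      2 * (ε * errorLevel m r M u z) := by
  have hR : 0 ≤ (totalR r)⁻¹ := inv_nonneg.2 (Finset.sum_nonneg fun i _ => Nat.cast_nonneg _)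
  have hi : ∀ i, |∑ j ∈ Finset.Icc 1 (r i), (Real.log (orderStat (x i) j) -
      Real.log (orderStat (x i) (r i + 1))) - γ * ∑ l ∈ Finset.Icc 1 (r i), z i l| ≤
      (r i : ℝ) * (2 * (ε * (1 + Real.exp (M * (u - spacingSum (z i) (m i) (r i + 1)))))) := by
    intro i
    rw [← sum_spacingSum_sub (z := z i) (show r i ≤ m i by have := hrm i; omega), Finset.mul_sum,
      ← Finset.sum_sub_distrib]
    refine (Finset.abs_sum_le_sum_abs _ _).trans ?_
    have hcard : (r i : ℝ) = ((Finset.Icc 1 (r i)).card : ℝ) := by simp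
    rw [hcard, ← nsmul_eq_mul]
    refine Finset.sum_le_card_nsmul _ _ _ fun j hj => ?_
    rw [Finset.mem_Icc] at hj
    have hij := hrm i
    rw [hx i j ⟨hj.1, by omega⟩, hx i (r i + 1) ⟨by omega, hij⟩]
    have h1 := hH _ (spacingSum_nonneg (hz i) (m i) j)
    have h2 := hH _ (spacingSum_nonneg (hz i) (m i) (r i + 1))
    -- The error factor is largest at the lowest order statistic used, so the one at rank `r i + 1`
    -- serves for all `j`.
    have h3 : ε * (1 + Real.exp (M * (u - spacingSum (z i) (m i) j))) ≤
        ε * (1 + Real.exp (M * (u - spacingSum (z i) (m i) (r i + 1)))) := by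
      have := spacingSum_antitone (hz i) (m i) (show j ≤ r i + 1 by omega)
      gcongr
    rw [abs_le] at h1 h2 ⊢
    constructor <;> linarith [h1.1, h1.2, h2.1, h2.2]
  have heq : gammaHat r x - γ * ((totalR r)⁻¹ * ∑ i, ∑ l ∈ Finset.Icc 1 (r i), z i l) =
      (totalR r)⁻¹ * ∑ i, (∑ j ∈ Finset.Icc 1 (r i), (Real.log (orderStat (x i) j) -
      Real.log (orderStat (x i) (r i + 1))) - γ * ∑ l ∈ Finset.Icc 1 (r i), z i l) := by
    rw [Finset.sum_sub_distrib, ← Finset.mul_sum, gammaHat]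
    ring
  rw [heq, abs_mul, abs_of_nonneg hR]
  refine (mul_le_mul_of_nonneg_left ((Finset.abs_sum_le_sum_abs _ _).trans
    (Finset.sum_le_sum fun i _ => hi i)) hR).trans (le_of_eq ?_)
  rw [errorLevel, mul_left_comm ε, mul_left_comm 2, Finset.mul_sum _ _ ε, Finset.mul_sum _ _ 2]
  congr 1
  exact Finset.sum_congr rfl fun i _ => by ring

/-- The weighted mean of the log intermediate order statistics, up to the error of the tail
approximation. -/
lemma abs_logLevel_sub_le {γ c ε M u p : ℝ} {H : ℝ → ℝ} {z : Fin k → ℕ → ℝ}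
    {x : (i : Fin k) → Fin (m i) → ℝ} (hz : ∀ i l, 0 ≤ z i l)
    (hR : 0 < totalR r) (hrm : ∀ i, r i + 1 ≤ m i)
    (hH : ∀ w ≥ 0, |H w - γ * w - c| ≤ ε * (1 + Real.exp (M * (u - w))))
    (hx : ∀ i j, 1 ≤ j ∧ j ≤ m i → Real.log (orderStat (x i) j) = H (spacingSum (z i) (m i) j)) :
    |(totalR r)⁻¹ * (∑ i, (r i : ℝ) * Real.log (orderStat (x i) (r i + 1))) -
      (γ * centredLevel m r z + γ * (weightedA m r p - Real.log p) + c)| ≤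
      ε * errorLevel m r M u z := by
  have hRi : 0 ≤ (totalR r)⁻¹ := inv_nonneg.2 hR.le
  have hsplit : centredLevel m r z + (weightedA m r p - Real.log p) =
      (totalR r)⁻¹ * ∑ i, (r i : ℝ) * spacingSum (z i) (m i) (r i + 1) := by
    have h1 : Real.log p = (totalR r)⁻¹ * ∑ i, (r i : ℝ) * Real.log p := by
      rw [← Finset.sum_mul, ← totalR, inv_mul_cancel_left₀ hR.ne']
    rw [centredLevel, weightedA]
    nth_rewrite 1 [h1]
    rw [← mul_sub, ← mul_add, ← Finset.sum_sub_distrib, ← Finset.sum_add_distrib]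
    congr 1
    refine Finset.sum_congr rfl fun i _ => ?_
    rw [blockA, ← mul_sub, add_sub_cancel_right, ← mul_add, ← Finset.sum_add_distrib, spacingSum]
    congr 1
    exact Finset.sum_congr rfl fun l _ => by ring
  have hc : c = (totalR r)⁻¹ * ∑ i, (r i : ℝ) * c := by
    rw [← Finset.sum_mul, ← totalR, inv_mul_cancel_left₀ hR.ne']
  have heq : (totalR r)⁻¹ * (∑ i, (r i : ℝ) * Real.log (orderStat (x i) (r i + 1))) -
      (γ * centredLevel m r z + γ * (weightedA m r p - Real.log p) + c) =
      (totalR r)⁻¹ * ∑ i, (r i : ℝ) * (Real.log (orderStat (x i) (r i + 1)) -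
        γ * spacingSum (z i) (m i) (r i + 1) - c) := by
    rw [← mul_add, hsplit]
    nth_rw 1 [hc]
    rw [mul_left_comm γ, ← mul_add, ← mul_sub, Finset.mul_sum, ← Finset.sum_add_distrib,
      ← Finset.sum_sub_distrib]
    congr 1
    exact Finset.sum_congr rfl fun i _ => by ring
  rw [heq, abs_mul, abs_of_nonneg hRi, errorLevel, mul_left_comm ε, Finset.mul_sum _ _ ε]
  refine mul_le_mul_of_nonneg_left ((Finset.abs_sum_le_sum_abs _ _).trans
    (Finset.sum_le_sum fun i _ => ?_)) hRi
  rw [abs_mul, abs_of_nonneg (Nat.cast_nonneg _), mul_left_comm ε]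
  refine mul_le_mul_of_nonneg_left ?_ (Nat.cast_nonneg _)
  rw [hx i (r i + 1) ⟨by omega, hrm i⟩]
  exact hH _ (spacingSum_nonneg (hz i) _ _)

/-- The normalized error of the quantile estimator is a normalized sum of centred spacings up to
an explicit remainder. -/
lemma abs_quantileHat_error_sub_le {γ c ε M u p L : ℝ} {H : ℝ → ℝ} {z : Fin k → ℕ → ℝ}
    {x : (i : Fin k) → Fin (m i) → ℝ} (hγ : 0 < γ) (hM : 0 ≤ M) (hε : 0 ≤ ε)
    (hz : ∀ i l, 0 ≤ z i l) (hR : 0 < totalR r) (hrm : ∀ i, r i + 1 ≤ m i)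
    (ha : weightedA m r p < 0)
    (hH : ∀ w ≥ 0, |H w - γ * w - c| ≤ ε * (1 + Real.exp (M * (u - w))))
    (hx : ∀ i j, 1 ≤ j ∧ j ≤ m i → Real.log (orderStat (x i) j) = H (spacingSum (z i) (m i) j))
    (hL : |L - γ * (-Real.log p) - c| ≤ 2 * ε) :
    |Real.sqrt (totalR r) / |weightedA m r p| * (Real.log (quantileHat r p x) - L) -
      γ * (Real.sqrt (totalR r))⁻¹ * ∑ i, ∑ l ∈ Finset.Icc 1 (r i), (z i l - 1)| ≤
    Real.sqrt (totalR r) / |weightedA m r p| *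
        (γ * |centredLevel m r z| + ε * errorLevel m r M u z + 2 * ε) +
      Real.sqrt (totalR r) * (2 * (ε * errorLevel m r M u z)) := by
  have h1 := abs_gammaHat_sub_le hM hε hz hrm hH hx
  have h2 := abs_logLevel_sub_le (p := p) hz hR hrm hH hx
  set a := weightedA m r p
  set R := totalR r
  set N := centredLevel m r z
  set B := errorLevel m r M u z
  have hsum : ∑ i, ∑ l ∈ Finset.Icc 1 (r i), (z i l - 1) =
      (∑ i, ∑ l ∈ Finset.Icc 1 (r i), z i l) - R := by
    simp only [Finset.sum_sub_distrib, Finset.sum_const, Nat.card_Icc, nsmul_eq_mul, mul_one, R,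
      totalR, Nat.add_sub_cancel]
  set G := ∑ i, ∑ l ∈ Finset.Icc 1 (r i), z i l
  set Q := R⁻¹ * ∑ i, (r i : ℝ) * Real.log (orderStat (x i) (r i + 1))
  have hs : 0 < Real.sqrt R := Real.sqrt_pos.2 hR
  have hss : Real.sqrt R * Real.sqrt R = R := Real.mul_self_sqrt hR.le
  have ha' : |a| = -a := abs_of_neg ha
  have hlog : Real.log (quantileHat r p x) = Q - a * gammaHat r x := by
    rw [quantileHat, Real.log_exp]
  have hinv : (Real.sqrt R)⁻¹ = Real.sqrt R / R := by
    rw [eq_div_iff hR.ne', inv_mul_eq_div, div_eq_iff hs.ne', hss]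
  -- Here `a < 0` turns `-a / |a|` into `1`, and the unknown `c` and `log p` cancel.
  have hid : Real.sqrt R / |a| * (Real.log (quantileHat r p x) - L) -
      γ * (Real.sqrt R)⁻¹ * (G - R) =
      Real.sqrt R / |a| * (γ * N + (Q - (γ * N + γ * (a - Real.log p) + c)) -
        (L - γ * (-Real.log p) - c)) +
      Real.sqrt R * (gammaHat r x - γ * (R⁻¹ * G)) := by
    rw [hlog, ha', hinv]
    have := ha.ne
    field_simp
    ring
  rw [hsum, hid]
  have hfac : 0 ≤ Real.sqrt R / |a| := div_nonneg hs.le (abs_nonneg _)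
  refine (abs_add_le _ _).trans ?_
  rw [abs_mul, abs_mul, abs_of_nonneg hfac, abs_of_nonneg hs.le]
  refine add_le_add (mul_le_mul_of_nonneg_left ?_ hfac) (mul_le_mul_of_nonneg_left h1 hs.le)
  refine (abs_sub _ _).trans (add_le_add ((abs_add_le _ _).trans (add_le_add ?_ h2)) hL)
  rw [abs_mul, abs_of_pos hγ]

end

end BlockQuantile

end

noncomputable section

namespace BlockQuantile

/-! ### Bounds for harmonic sums and products -/

lemma sum_one_div_le_log_sub {r m : ℕ} (hr : 1 ≤ r) (h : r ≤ m) :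
    ∑ l ∈ Finset.Icc (r + 1) m, 1 / (l : ℝ) ≤ Real.log m - Real.log r := by
  induction m, h using Nat.le_induction with
  | base => simp
  | succ m hm ih =>
    rw [Finset.sum_Icc_succ_top (by omega)]
    have hm0 : (0 : ℝ) < m := by exact_mod_cast (by omega : 0 < m)
    have h1 := Real.one_sub_inv_le_log_of_pos (show 0 < ((m + 1 : ℕ) : ℝ) / m by positivity)
    rw [Real.log_div (by positivity) hm0.ne', inv_div] at h1
    have h2 : 1 - (m : ℝ) / ((m + 1 : ℕ) : ℝ) = 1 / ((m + 1 : ℕ) : ℝ) := by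
      push_cast
      field_simp
      ring
    linarith

/-- The left side is `1 - M/(x+M) ≤ exp (-M/(x+M))`. The right side is chosen so that the product
over consecutive `x` telescopes. -/
lemma one_div_one_add_le_rpow {M x : ℝ} (hM : 0 ≤ M) (hx : 0 < x) :
    1 / (1 + M / x) ≤ ((x + M) / (x + M + 1)) ^ M := by
  have hxM : 0 < x + M := by linarith
  rw [Real.rpow_def_of_pos (by positivity)]
  have h1 := Real.one_sub_inv_le_log_of_pos (show 0 < (x + M) / (x + M + 1) by positivity)
  have h2 : 1 - ((x + M) / (x + M + 1))⁻¹ = -(1 / (x + M)) := by field_simp; ring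
  rw [h2] at h1
  calc 1 / (1 + M / x) = -(1 / (x + M)) * M + 1 := by field_simp; ring
    _ ≤ Real.exp (-(1 / (x + M)) * M) := Real.add_one_le_exp _
    _ ≤ _ := Real.exp_le_exp.2 (mul_le_mul_of_nonneg_right h1 hM)

lemma prod_one_div_one_add_le {M : ℝ} (hM : 0 ≤ M) {r m : ℕ} (h : r ≤ m) :
    ∏ l ∈ Finset.Icc (r + 1) m, 1 / (1 + M / (l : ℝ)) ≤
      ((r + 1 + M) / (m + 1 + M)) ^ M := by
  induction m, h using Nat.le_induction with
  | base =>
    rw [div_self (by positivity)]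
    simp
  | succ m hm ih =>
    rw [Finset.prod_Icc_succ_top (by omega)]
    have h1 := one_div_one_add_le_rpow hM (show (0 : ℝ) < ((m + 1 : ℕ) : ℝ) by positivity)
    refine (mul_le_mul ih h1 (by positivity) (by positivity)).trans (le_of_eq ?_)
    rw [← Real.mul_rpow (by positivity) (by positivity)]
    congr 1
    push_cast
    field_simp
    ring

/-! ### Expected size of the remainder terms -/

section

variable {Ω : Type*} [MeasurableSpace Ω] {P : Measure Ω}

lemma ae_nonneg_of_hasLaw_exp {ι : Type*} [Countable ι] {Y : ι → Ω → ℝ}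
    (hY : ∀ s, HasLaw (Y s) (expMeasure 1) P) : ∀ᵐ ω ∂P, ∀ s, 0 ≤ Y s ω := by
  refine ae_all_iff.2 fun s => ae_of_ae_map (hY s).aemeasurable ?_
  rw [(hY s).map_eq]
  exact ae_nonneg_expMeasure

variable [IsProbabilityMeasure P]

/-- Exponential moments of the relative size of an intermediate order statistic. -/
lemma integral_exp_spacingSum_le {Y : ℕ → Ω → ℝ} (hY : ∀ l, HasLaw (Y l) (expMeasure 1) P)
    (hi : iIndepFun Y P) {M q : ℝ} (hM : 0 ≤ M) (hq : 0 < q) {r m : ℕ} (hr : 1 ≤ r)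
    (hrm : r ≤ m) (hqm : q ≤ m / r) :
    Integrable (fun ω => Real.exp (M * (Real.log q - spacingSum (fun l => Y l ω) m (r + 1)))) P ∧
      ∫ ω, Real.exp (M * (Real.log q - spacingSum (fun l => Y l ω) m (r + 1))) ∂P ≤
        (2 + M) ^ M := by
  have hmeas : AEMeasurable (fun ω => spacingSum (fun l => Y l ω) m (r + 1)) P :=
    Finset.aemeasurable_fun_sum _ fun l _ => (hY l).aemeasurable.div_const _
  constructor
  · refine Integrable.of_bound (C := Real.exp (M * Real.log q))
      (((hmeas.const_sub _).const_mul M).exp.aestronglyMeasurable) ?_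
    filter_upwards [ae_nonneg_of_hasLaw_exp hY] with ω hω
    rw [Real.norm_eq_abs, Real.abs_exp]
    refine Real.exp_le_exp.2 (mul_le_mul_of_nonneg_left ?_ hM)
    linarith [spacingSum_nonneg hω m (r + 1)]
  · have hrepr : ∀ ω, Real.exp (M * (Real.log q - spacingSum (fun l => Y l ω) m (r + 1))) =
        q ^ M * Real.exp (-∑ l ∈ Finset.Icc (r + 1) m, M / (l : ℝ) * Y l ω) := by
      intro ω
      rw [Real.rpow_def_of_pos hq, ← Real.exp_add, spacingSum, mul_sub, sub_eq_add_neg,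
        Finset.mul_sum, mul_comm M]
      congr 3
      exact Finset.sum_congr rfl fun l _ => by ring
    simp only [hrepr]
    rw [integral_const_mul, integral_exp_neg_sum hY hi fun l => div_nonneg hM (Nat.cast_nonneg l)]
    have hr0 : (1 : ℝ) ≤ r := by exact_mod_cast hr
    have hm0 : (0 : ℝ) < m := by exact_mod_cast (by omega : 0 < m)
    -- The Laplace transform decays like `(r / m) ^ M`, which offsets `q ^ M` because `q ≤ m / r`.
    refine (mul_le_mul_of_nonneg_left (prod_one_div_one_add_le hM hrm) (by positivity)).trans ?_
    rw [← Real.mul_rpow hq.le (by positivity)]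
    refine Real.rpow_le_rpow (by positivity) ?_ hM
    calc q * ((r + 1 + M) / (m + 1 + M)) ≤ m / r * ((r + 1 + M) / (m + 1 + M)) := by gcongr
      _ ≤ m / r * ((r + 1 + M) / m) := by gcongr; linarith
      _ = (r + 1 + M) / r := by field_simp
      _ ≤ 2 + M := by
        rw [div_le_iff₀ (by linarith)]
        nlinarith

variable {Z : ℕ × ℕ → Ω → ℝ} {k : ℕ} {m r : Fin k → ℕ}

/-- The weights `r i / totalR r` sum to one, so the bound for a single block survives averaging,
uniformly in the number of blocks. -/
lemma integral_errorLevel_le (hZ : ∀ s, HasLaw (Z s) (expMeasure 1) P) (hi : iIndepFun Z P)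
    (hR : 0 < totalR r) (hr : ∀ i, 1 ≤ r i) (hrm : ∀ i, r i + 1 ≤ m i) {M q : ℝ} (hM : 0 ≤ M)
    (hq : 0 < q) (hqm : ∀ i, q ≤ (m i : ℝ) / r i) :
    Integrable (fun ω => errorLevel m r M (Real.log q) fun i l => Z (i, l) ω) P ∧
      ∫ ω, errorLevel m r M (Real.log q) (fun i l => Z (i, l) ω) ∂P ≤ 1 + (2 + M) ^ M := by
  have hb := fun i : Fin k => integral_exp_spacingSum_le (fun l => hZ (i, l))
    (hi.precomp (g := fun l : ℕ => ((i : ℕ), l)) fun a b h => (Prod.ext_iff.1 h).2) hM hq (hr i)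
    (show r i ≤ m i by have := hrm i; omega) (hqm i)
  have hint : ∀ i : Fin k, Integrable (fun ω => (r i : ℝ) * (1 + Real.exp (M * (Real.log q -
      spacingSum (fun l => Z (i, l) ω) (m i) (r i + 1))))) P := fun i =>
    ((integrable_const 1).add (hb i).1).const_mul _
  refine ⟨(integrable_finsetSum _ fun i _ => hint i).const_mul _, ?_⟩
  simp only [errorLevel]
  rw [integral_const_mul, integral_finsetSum _ fun i _ => hint i, inv_mul_le_iff₀ hR, totalR,
    Finset.sum_mul]
  refine Finset.sum_le_sum fun i _ => ?_
  rw [integral_const_mul, integral_add (integrable_const 1) (hb i).1]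
  simp only [integral_const, probReal_univ, smul_eq_mul, mul_one]
  exact mul_le_mul_of_nonneg_left (add_le_add_right (hb i).2 1) (Nat.cast_nonneg _)

/-- Since `∑_{l > r} 1 / l² ≤ 1 / r`, block `i` contributes at most `r_i / R²` to the variance, for
a total of `1 / R`. -/
lemma integral_abs_centredLevel_le (hZ : ∀ s, HasLaw (Z s) (expMeasure 1) P) (hi : iIndepFun Z P)
    (hR : 0 < totalR r) (hr : ∀ i, 1 ≤ r i) (hrm : ∀ i, r i + 1 ≤ m i) :
    Integrable (fun ω => centredLevel m r fun i l => Z (i, l) ω) P ∧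
      ∫ ω, |centredLevel m r fun i l => Z (i, l) ω| ∂P ≤ (Real.sqrt (totalR r))⁻¹ := by
  set Y : ((_ : Fin k) × ℕ) → Ω → ℝ := fun s => Z (s.1, s.2)
  have hYi : iIndepFun Y P := hi.precomp (g := fun s : (_ : Fin k) × ℕ => ((s.1 : ℕ), s.2)) (by
    rintro ⟨a, b⟩ ⟨a', b'⟩ h
    simp only [Prod.mk.injEq, Fin.val_inj] at h
    rw [h.1, h.2])
  set c : ((_ : Fin k) × ℕ) → ℝ := fun s => (totalR r)⁻¹ * r s.1 / s.2
  set S : Finset ((_ : Fin k) × ℕ) :=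
    (Finset.univ : Finset (Fin k)).sigma fun i => Finset.Icc (r i + 1) (m i)
  have h := integral_abs_sum_le (Y := Y) (fun s => hZ _) hYi c S
  have heq : ∀ ω, ∑ s ∈ S, c s * (Y s ω - 1) = centredLevel m r fun i l => Z (i, l) ω := by
    intro ω
    rw [Finset.sum_sigma, centredLevel, Finset.mul_sum]
    refine Finset.sum_congr rfl fun i _ => ?_
    rw [Finset.mul_sum, Finset.mul_sum]
    refine Finset.sum_congr rfl fun l _ => ?_
    simp only [c, Y]
    ring
  simp only [heq] at h
  refine ⟨h.1, h.2.trans ?_⟩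
  rw [← Real.sqrt_inv]
  refine Real.sqrt_le_sqrt ?_
  have hi' : ∀ i, ∑ l ∈ Finset.Icc (r i + 1) (m i), c ⟨i, l⟩ ^ 2 ≤
      (totalR r)⁻¹ ^ 2 * r i := by
    intro i
    have hr0 : (0 : ℝ) < r i := by exact_mod_cast hr i
    have h1 := sum_Ioc_inv_sq_le_sub (α := ℝ) (k := r i) (n := m i) (by have := hr i; omega)
      (by have := hrm i; omega)
    have h2 : Finset.Icc (r i + 1) (m i) = Finset.Ioc (r i) (m i) := by
      ext l
      simp only [Finset.mem_Icc, Finset.mem_Ioc]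
      omega
    have h3 : ∑ l ∈ Finset.Ioc (r i) (m i), ((l : ℝ) ^ 2)⁻¹ ≤ (r i : ℝ)⁻¹ :=
      h1.trans (sub_le_self _ (by positivity))
    calc ∑ l ∈ Finset.Icc (r i + 1) (m i), c ⟨i, l⟩ ^ 2
        = ((totalR r)⁻¹ * r i) ^ 2 * ∑ l ∈ Finset.Ioc (r i) (m i), ((l : ℝ) ^ 2)⁻¹ := by
          rw [h2, Finset.mul_sum]
          refine Finset.sum_congr rfl fun l _ => ?_
          simp only [c]
          rw [div_pow, div_eq_mul_inv]
      _ ≤ ((totalR r)⁻¹ * r i) ^ 2 * (r i : ℝ)⁻¹ :=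
          mul_le_mul_of_nonneg_left h3 (sq_nonneg _)
      _ = _ := by field_simp
  rw [Finset.sum_sigma]
  refine (Finset.sum_le_sum fun i _ => hi' i).trans (le_of_eq ?_)
  rw [← Finset.mul_sum, ← totalR]
  field_simp

end

/-! ### The normalizing sequence -/

/-- Each `blockA` is at most `log (m p / r) ≤ log (m p)`, and an average preserves the bound. -/
lemma weightedA_le_log {k : ℕ} {m r : Fin k → ℕ} (hR : 0 < totalR r) (hr : ∀ i, 1 ≤ r i)
    (hrm : ∀ i, r i + 1 ≤ m i) {p s : ℝ} (hp : 0 < p) (hs : ∀ i, (m i : ℝ) * p ≤ s) :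
    weightedA m r p ≤ Real.log s := by
  rw [weightedA, inv_mul_le_iff₀ hR, totalR, Finset.sum_mul]
  refine Finset.sum_le_sum fun i _ => mul_le_mul_of_nonneg_left ?_ (Nat.cast_nonneg _)
  have hm : (0 : ℝ) < m i := by exact_mod_cast (by have := hrm i; omega : 0 < m i)
  have h1 := sum_one_div_le_log_sub (hr i) (show r i ≤ m i by have := hrm i; omega)
  have h2 : 0 ≤ Real.log (r i) := Real.log_nonneg (by exact_mod_cast hr i)
  have h3 := Real.log_le_log (mul_pos hm hp) (hs i)
  rw [Real.log_mul hm.ne' hp.ne'] at h3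
  rw [blockA]
  linarith

/-- The normalized error of the log quantile estimator, as a function of the sample. -/
def normalizedError {k : ℕ} (m r : Fin k → ℕ) (p L : ℝ) (x : (i : Fin k) → Fin (m i) → ℝ) : ℝ :=
  Real.sqrt (totalR r) / |weightedA m r p| * (Real.log (quantileHat r p x) - L)

lemma measurable_normalizedError {k : ℕ} (m r : Fin k → ℕ) (p L : ℝ) :
    Measurable (normalizedError m r p L) := by
  have h : ∀ i j, Measurable fun x : (i : Fin k) → Fin (m i) → ℝ => orderStat (x i) j := fun i j =>
    (measurable_orderStat j).comp (measurable_pi_apply i)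
  unfold normalizedError quantileHat gammaHat
  fun_prop

/-- The sample enters only through its order statistics, so the joint law of the sorted blocks
determines that of the error. -/
lemma normalizedError_sortVec {k : ℕ} (m r : Fin k → ℕ) (p L : ℝ)
    (x : (i : Fin k) → Fin (m i) → ℝ) :
    normalizedError m r p L (fun i => sortVec (x i)) = normalizedError m r p L x := by
  simp only [normalizedError, quantileHat, gammaHat, orderStat_sortVec]

end BlockQuantile

end

/-! ### Assembly: the limit theorem for the exponential representation -/

noncomputable section

namespace BlockQuantile

section

variable {μ : Measure ℝ} {γ ρ : ℝ} {A : ℝ → ℝ} {k : ℕ → ℕ}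
  {m r : (n : ℕ) → Fin (k n) → ℕ} {q p : ℕ → ℝ}

lemma le_totalR {k : ℕ} {r : Fin k → ℕ} (hr : ∀ i, 1 ≤ r i) : (k : ℝ) ≤ totalR r := by
  have h : ∑ _i : Fin k, (1 : ℝ) ≤ totalR r :=
    Finset.sum_le_sum fun i _ => by exact_mod_cast hr i
  simpa using h

/-- The normalizing sequence tends to `-∞`. -/
lemma tendsto_weightedA_atBot (hr : ∀ n i, 1 ≤ r n i) (hrm : ∀ n i, r n i + 1 ≤ m n i)
    (hk : Tendsto k atTop atTop) (hp : ∀ n, p n ∈ Set.Ioo (0 : ℝ) 1)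
    (hmp : Tendsto (fun n => ⨆ i, (m n i : ℝ) * p n) atTop (𝓝 0)) :
    Tendsto (fun n => weightedA (m n) (r n) (p n)) atTop atBot := by
  have hle : ∀ n i, (m n i : ℝ) * p n ≤ ⨆ i, (m n i : ℝ) * p n := fun n i =>
    le_ciSup (f := fun i => (m n i : ℝ) * p n) (Set.finite_range _).bddAbove i
  have hpos : ∀ᶠ n in atTop, 0 < ⨆ i, (m n i : ℝ) * p n := by
    filter_upwards [hk.eventually_ge_atTop 1] with n hn
    refine lt_of_lt_of_le (mul_pos ?_ (hp n).1) (hle n ⟨0, hn⟩)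
    exact_mod_cast (by have := hrm n ⟨0, hn⟩; omega)
  have hlog : Tendsto (fun n => Real.log (⨆ i, (m n i : ℝ) * p n)) atTop atBot :=
    Real.tendsto_log_nhdsGT_zero.comp
      (tendsto_nhdsWithin_iff.2 ⟨hmp, hpos⟩)
  refine tendsto_atBot_mono' _ ?_ hlog
  filter_upwards [hk.eventually_ge_atTop 1] with n hn
  have hR : 0 < totalR (r n) := lt_of_lt_of_le (by exact_mod_cast hn) (le_totalR (hr n))
  exact weightedA_le_log hR (hr n) (hrm n) (hp n).1 (hle n)

lemma integral_affine {Ω : Type*} [MeasurableSpace Ω] {P : Measure Ω} [IsProbabilityMeasure P]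
    {f g : Ω → ℝ} (hf : Integrable f P) (hg : Integrable g P) (α β δ : ℝ) :
    Integrable (fun ω => α * f ω + β * g ω + δ) P ∧
      ∫ ω, (α * f ω + β * g ω + δ) ∂P = α * ∫ ω, f ω ∂P + β * ∫ ω, g ω ∂P + δ := by
  have h : Integrable (fun ω => α * f ω + β * g ω) P := (hf.const_mul α).add (hg.const_mul β)
  refine ⟨h.add (integrable_const δ), ?_⟩
  rw [integral_add h (integrable_const δ), integral_add (hf.const_mul α) (hg.const_mul β),
    integral_const_mul, integral_const_mul]
  simp

/-- The limit theorem in Rényi's exponential representation. -/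
lemma tendstoInDistribution_normalizedError [IsProbabilityMeasure μ] (hμ : ∀ᵐ x ∂μ, 1 ≤ x)
    (hγ : 0 < γ) (hρ : ρ < 0) (hU : SecondOrder μ γ ρ A)
    (hr : ∀ n i, 1 ≤ r n i) (hrm : ∀ n i, r n i + 1 ≤ m n i) (hk : Tendsto k atTop atTop)
    (hq : ∀ n, q n = ⨅ i, (m n i : ℝ) / (r n i : ℝ)) (hq_top : Tendsto q atTop atTop)
    (hA : Tendsto (fun n => Real.sqrt (totalR (r n)) * A (q n)) atTop (𝓝 0))
    (hp : ∀ n, p n ∈ Set.Ioo (0 : ℝ) 1)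
    (hmp : Tendsto (fun n => ⨆ i, (m n i : ℝ) * p n) atTop (𝓝 0))
    {Ω : Type*} [MeasurableSpace Ω] {P : Measure Ω} [IsProbabilityMeasure P] {Z : ℕ × ℕ → Ω → ℝ}
    (hZ : ∀ s, HasLaw (Z s) (expMeasure 1) P) (hi : iIndepFun Z P) :
    TendstoInDistribution
      (fun n ω => normalizedError (m n) (r n) (p n) (Real.log (highQuantile μ (p n)))
        fun i j => tailQuantile μ
          (Real.exp (renyiVec (fun l : Fin (m n i) => Z (i, m n i - l) ω) j)))
      atTop (id : ℝ → ℝ) (fun _ => P) (gaussianReal 0 (γ ^ 2).toNNReal) := by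
  obtain ⟨c, K, M, T, hK, hM, hH⟩ := hU.log_tailQuantile_approx hμ hρ
  set D : ℕ → Ω → ℝ := fun n ω =>
    normalizedError (m n) (r n) (p n) (Real.log (highQuantile μ (p n)))
      fun i j => tailQuantile μ
        (Real.exp (renyiVec (fun l : Fin (m n i) => Z (i, m n i - l) ω) j))
  -- the leading term
  set Y : ∀ n, ((_ : Fin (k n)) × ℕ) → Ω → ℝ := fun n s => Z (s.1, s.2)
  have hYi : ∀ n, iIndepFun (Y n) P := fun n =>
    hi.precomp (g := fun s : (_ : Fin (k n)) × ℕ => ((s.1 : ℕ), s.2)) (by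
      rintro ⟨a, b⟩ ⟨a', b'⟩ h
      simp only [Prod.mk.injEq, Fin.val_inj] at h
      rw [h.1, h.2])
  set S : ∀ n, Finset ((_ : Fin (k n)) × ℕ) := fun n =>
    (Finset.univ : Finset (Fin (k n))).sigma fun i => Finset.Icc 1 (r n i)
  have hcard : ∀ n, ((S n).card : ℝ) = totalR (r n) := by
    intro n
    simp [S, totalR]
  have hScard : Tendsto (fun n => (S n).card) atTop atTop := by
    refine tendsto_atTop_mono (fun n => ?_) hk
    have := le_totalR (hr n)
    rw [← hcard n] at this
    exact_mod_cast this
  have hlead := tendstoInDistribution_exponential_rows (fun n s => hZ _) hYi S hScard γ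
  set V : ℕ → Ω → ℝ := fun n ω => γ * (Real.sqrt (S n).card)⁻¹ * ∑ s ∈ S n, (Y n s ω - 1) with hV
  have hVeq : ∀ n ω, V n ω = γ * (Real.sqrt (totalR (r n)))⁻¹ *
      ∑ i, ∑ l ∈ Finset.Icc 1 (r n i), (Z (i, l) ω - 1) := by
    intro n ω
    simp only [hV, hcard]
    rw [Finset.sum_sigma]
  -- the remainder
  have hDm : ∀ n, AEMeasurable (D n) P := by
    intro n
    refine (measurable_normalizedError _ _ _ _).comp_aemeasurable ?_
    refine aemeasurable_pi_lambda _ fun i => aemeasurable_pi_lambda _ fun j => ?_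
    refine (monotone_tailQuantile_exp hμ).measurable.comp_aemeasurable ?_
    exact Finset.aemeasurable_fun_sum _ fun l _ => (hZ _).aemeasurable.div_const _
  have ha_bot := tendsto_weightedA_atBot hr hrm hk hp hmp
  have ha_inv : Tendsto (fun n => |weightedA (m n) (r n) (p n)|⁻¹) atTop (𝓝 0) :=
    (tendsto_abs_atBot_atTop.comp ha_bot).inv_tendsto_atTop
  set C := 1 + (2 + M) ^ M
  set ε : ℕ → ℝ := fun n => K * |A (q n)|
  -- This bounds the mean of the remainder in `abs_quantileHat_error_sub_le`, with `E|N| ≤ R^{-1/2}`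
  -- and mean error factor at most `C`.
  set b : ℕ → ℝ := fun n => γ * |weightedA (m n) (r n) (p n)|⁻¹ +
    Real.sqrt (totalR (r n)) * ε n * ((C + 2) * |weightedA (m n) (r n) (p n)|⁻¹ + 2 * C)
  have hb : Tendsto b atTop (𝓝 0) := by
    have h1 : Tendsto (fun n => Real.sqrt (totalR (r n)) * ε n) atTop (𝓝 0) := by
      have h2 := hA.abs.const_mul K
      rw [abs_zero, mul_zero] at h2
      refine h2.congr fun n => ?_
      rw [abs_mul, abs_of_nonneg (Real.sqrt_nonneg _)]
      simp only [ε]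
      ring
    have h2 := (ha_inv.const_mul γ).add (h1.mul ((ha_inv.const_mul (C + 2)).add_const (2 * C)))
    simpa using h2
  have hrem : TendstoInMeasure P (fun n => D n - V n) atTop fun _ => 0 := by
    refine tendstoInMeasure_zero_of_integral_le hb ?_
    filter_upwards [hk.eventually_ge_atTop 1, ha_bot.eventually_lt_atBot 0,
      hq_top.eventually_gt_atTop 0, (Real.tendsto_log_atTop.comp hq_top).eventually_ge_atTop T,
      hmp.eventually_lt_const zero_lt_one] with n hkn han hqn hTn hmpn
    have hR : 0 < totalR (r n) := lt_of_lt_of_le (by exact_mod_cast hkn) (le_totalR (hr n))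
    have hqm : ∀ i, q n ≤ (m n i : ℝ) / r n i := fun i => by
      rw [hq n]
      exact ciInf_le (Set.finite_range _).bddBelow i
    have hB := integral_errorLevel_le hZ hi hR (hr n) (hrm n) hM hqn hqm
    have hN := integral_abs_centredLevel_le hZ hi hR (hr n) (hrm n)
    have hs : 0 < Real.sqrt (totalR (r n)) := Real.sqrt_pos.2 hR
    have hεn : 0 ≤ ε n := mul_nonneg hK (abs_nonneg _)
    -- The target level `1 / p` lies beyond `q`, since `q ≤ m_i` and `m_i p < 1`; hence the error
    -- factor at `x_p` is at most `2`.
    have hup : Real.log (q n) ≤ -Real.log (p n) := by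
      have h1 : q n ≤ m n ⟨0, hkn⟩ :=
        (hqm _).trans (div_le_self (Nat.cast_nonneg _) (by exact_mod_cast hr n _))
      have h2 : (m n ⟨0, hkn⟩ : ℝ) * p n < 1 :=
        (le_ciSup (f := fun i => (m n i : ℝ) * p n) (Set.finite_range _).bddAbove _).trans_lt hmpn
      have h3 : q n * p n ≤ 1 := (mul_le_mul_of_nonneg_right h1 (hp n).1.le).trans h2.le
      have h4 := Real.log_nonpos (mul_pos hqn (hp n).1).le h3
      rw [Real.log_mul hqn.ne' (hp n).1.ne'] at h4
      linarith
    have hHn : ∀ w ≥ 0, |Real.log (tailQuantile μ (Real.exp w)) - γ * w - c| ≤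
        ε n * (1 + Real.exp (M * (Real.log (q n) - w))) := by
      intro w hw
      have := hH (Real.log (q n)) hTn w hw
      rwa [Real.exp_log hqn] at this
    have hLn : |Real.log (highQuantile μ (p n)) - γ * (-Real.log (p n)) - c| ≤ 2 * ε n := by
      rw [highQuantile_eq_tailQuantile μ (hp n).1]
      have hlp : 0 ≤ -Real.log (p n) := by
        have := Real.log_nonpos (hp n).1.le (hp n).2.le
        linarith
      refine (hHn _ hlp).trans ?_
      have h1 : Real.exp (M * (Real.log (q n) - -Real.log (p n))) ≤ 1 :=
        Real.exp_le_one_iff.2 (mul_nonpos_of_nonneg_of_nonpos hM (by linarith))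
      nlinarith
    set a := weightedA (m n) (r n) (p n)
    set R := totalR (r n)
    have hint := integral_affine hN.1.abs hB.1 (Real.sqrt R / |a| * γ)
      (Real.sqrt R / |a| * ε n + Real.sqrt R * (2 * ε n)) (Real.sqrt R / |a| * (2 * ε n))
    refine ⟨_, hint.1, ?_, ?_⟩
    · filter_upwards [ae_nonneg_of_hasLaw_exp hZ] with ω hω
      have := abs_quantileHat_error_sub_le (m := m n) (r := r n) (p := p n)
        (H := fun w => Real.log (tailQuantile μ (Real.exp w))) (z := fun i l => Z (i, l) ω)
        (x := fun i j => tailQuantile μ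
          (Real.exp (renyiVec (fun l : Fin (m n i) => Z (i, m n i - l) ω) j)))
        hγ hM hεn (fun i l => hω _) hR (hrm n) han hHn
        (fun i j hj => by
          rw [orderStat_tailQuantile_renyiVec hμ (z := fun l => Z (i, l) ω) (fun l => hω _) hj])
        hLn
      rw [Pi.sub_apply, hVeq]
      exact this.trans (le_of_eq (by ring))
    · rw [hint.2]
      have ha0 : 0 < |a| := abs_pos.2 han.ne
      calc _ ≤ Real.sqrt R / |a| * γ * (Real.sqrt R)⁻¹ +
            (Real.sqrt R / |a| * ε n + Real.sqrt R * (2 * ε n)) * C +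
            Real.sqrt R / |a| * (2 * ε n) := by
            gcongr
            · exact hN.2
            · exact hB.2
        _ = b n := by
            change _ = γ * |a|⁻¹ + Real.sqrt R * ε n * ((C + 2) * |a|⁻¹ + 2 * C)
            field_simp
            ring
  -- Slutsky: a remainder vanishing in probability does not change the limit law.
  have hsum := hlead.add_of_tendstoInMeasure_const hrem fun n =>
    (hDm n).sub (hlead.forall_aemeasurable n)
  refine hsum.congr (fun n => ae_of_all _ fun ω => ?_) (ae_of_all _ fun x => add_zero x)
  simp

end

end BlockQuantile

end

/-! ### Transfer of the limit to the given array -/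

theorem theorem4
    -- the common law of the observations
    (μ : Measure ℝ) [IsProbabilityMeasure μ] (hμ : ∀ᵐ x ∂μ, 1 ≤ x)
    (γ ρ : ℝ) (hγ : 0 < γ) (hρ : ρ < 0) (hF : BlockQuantile.HeavyTailed μ γ)
    (A : ℝ → ℝ) (hU : BlockQuantile.SecondOrder μ γ ρ A)
    -- for each `n`: `k n` blocks, block `i` of size `m n i` with `r n i + 1` observed maxima
    (k : ℕ → ℕ) (m r : (n : ℕ) → Fin (k n) → ℕ)
    (hr : ∀ n i, 1 ≤ r n i) (hrm : ∀ n i, r n i + 1 ≤ m n i)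
    (hn : (fun n : ℕ => ∑ i, (m n i : ℝ)) ~[atTop] (fun n : ℕ => (n : ℝ)))
    (hk : Tendsto k atTop atTop)
    (hnk : Tendsto (fun n : ℕ => (n : ℝ) / (k n : ℝ)) atTop atTop)
    (q : ℕ → ℝ) (hq : ∀ n, q n = ⨅ i, (m n i : ℝ) / (r n i : ℝ))
    (hq_top : Tendsto q atTop atTop)
    (hA : Tendsto (fun n => Real.sqrt (BlockQuantile.totalR (r n)) * A (q n)) atTop (𝓝 0))
    -- the level
    (p : ℕ → ℝ) (hp : ∀ n, p n ∈ Set.Ioo (0 : ℝ) 1)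
    (hmp : Tendsto (fun n => ⨆ i, (m n i : ℝ) * p n) atTop (𝓝 0))
    (ha : (fun n => BlockQuantile.weightedA (m n) (r n) (p n)) =o[atTop]
      (fun n => Real.sqrt (BlockQuantile.totalR (r n))))
    -- for each `n`, the observations are independent with law `μ`
    {Ω : ℕ → Type*} [∀ n, MeasurableSpace (Ω n)] (P : (n : ℕ) → Measure (Ω n))
    [∀ n, IsProbabilityMeasure (P n)]
    (X : (n : ℕ) → (i : Fin (k n)) → Fin (m n i) → Ω n → ℝ)
    (hlaw : ∀ n i l, HasLaw (X n i l) μ (P n))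
    (hindep : ∀ n, iIndepFun (fun s : (i : Fin (k n)) × Fin (m n i) => X n s.1 s.2) (P n)) :
    TendstoInDistribution
      (fun n ω =>
        Real.sqrt (BlockQuantile.totalR (r n)) / |BlockQuantile.weightedA (m n) (r n) (p n)| *
          (Real.log (BlockQuantile.quantileHat (r n) (p n) (fun i l => X n i l ω))
            - Real.log (BlockQuantile.highQuantile μ (p n))))
      atTop (id : ℝ → ℝ) P (gaussianReal 0 (γ ^ 2).toNNReal) := by
  have := isProbabilityMeasure_expMeasure one_pos
  -- One exponential family serves every `n`: convergence in distribution involves only the law of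
  -- each row, so no coupling between rows is required.
  obtain ⟨Ω', _, P', Z, -, hZ, hZi, _⟩ := exists_iid (ℕ × ℕ) (expMeasure 1)
  have hmain := BlockQuantile.tendstoInDistribution_normalizedError hμ hγ hρ hU hr hrm hk hq
    hq_top hA hp hmp hZ hZi
  have hident : ∀ n, IdentDistrib
      (fun ω => BlockQuantile.normalizedError (m n) (r n) (p n)
        (Real.log (BlockQuantile.highQuantile μ (p n))) fun i l => X n i l ω)
      (fun ω => BlockQuantile.normalizedError (m n) (r n) (p n)
        (Real.log (BlockQuantile.highQuantile μ (p n)))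
        fun i j => BlockQuantile.tailQuantile μ
          (Real.exp (BlockQuantile.renyiVec (fun l : Fin (m n i) => Z (i, m n i - l) ω) j)))
      (P n) P' := by
    intro n
    have hblocks := BlockQuantile.identDistrib_sortVec_renyiVec hμ (hlaw n) (hindep n)
      (Z := fun (i : Fin (k n)) (l : Fin (m n i)) => Z (i, m n i - l)) (fun i l => hZ _)
      -- The reversed index `m n i - l` is injective in `l` because `l < m n i`, so truncated
      -- subtraction never intervenes.
      (hZi.precomp (g := fun s : (i : Fin (k n)) × Fin (m n i) => ((s.1 : ℕ), m n s.1 - s.2)) (by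
        rintro ⟨a, b⟩ ⟨a', b'⟩ h
        simp only [Prod.mk.injEq, Fin.val_inj] at h
        obtain ⟨rfl, h⟩ := h
        have := b.2
        have := b'.2
        rw [show b = b' by ext; omega]))
    have h := hblocks.comp (BlockQuantile.measurable_normalizedError (m n) (r n) (p n)
      (Real.log (BlockQuantile.highQuantile μ (p n))))
    simpa only [Function.comp_def, BlockQuantile.normalizedError_sortVec] using h
  refine ⟨fun n => (hident n).aemeasurable_fst, hmain.aemeasurable_limit, ?_⟩
  refine hmain.tendsto.congr fun n => Subtype.ext ?_
  exact (hident n).map_eq.symm
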